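/- All manifolds are smooth, finite-dimensional, Hausdorff and without boundary, and all structures are smooth. **Conventions.** A *Jacobi manifold* $(M,\Lambda,R)$ is a manifold $M$ with a bivector field $\Lambda$ and a vector field $R$ such that $\{f,g\}=\Lambda(df,dg)+f\,R(g)-g\,R(f)$ is a Lie bracket on $C^\infty(M)$; $\Lambda$ is a *Poisson bivector* if $\{f,g\}=\Lambda(df,dg)$ is a Lie bracket (the case $R\equiv 0$). Write $\Lambda^\sharp(\beta)=\Lambda(\beta,\cdot)$. The *leaves* of $(M,\Lambda,R)$ are the leaves of its characteristic (singular) foliation, i.e. the sets of points that can be joined by finitely many integral curves of Hamiltonian vector fields $X_f=\Lambda^\sharp(df)+fR$, $f\in C^\infty(M)$; the leaf through $x$ is an immersed submanifold whose tangent space at $x$ is $\Lambda^\sharp(T^*_xM)+\mathbb{R}R_x$. A *Casimir* of a Poisson bivector $\pi$ is a function $\kappa\in C^\infty(M)$ with $\pi^\sharp(d\kappa)=0$. A *co-oriented contact groupoid* $(G,\alpha,F)$ over $M$ is a Lie groupoid $G\rightrightarrows M$ with source $s$, target $t$ and multiplication $m$ (where $gh$ is defined when $s(g)=t(h)$), a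 contact form $\alpha$ on $G$, and a Lie groupoid homomorphism $F:G\to\mathbb{R}^*$ such that $m^*\alpha=\mathrm{pr}_1^*\alpha+\mathrm{pr}_1^*(F)\,\mathrm{pr}_2^*\alpha$ on the manifold of composable pairs. Let $R^\alpha$ be the Reeb vector field of $\alpha$ ($\alpha(R^\alpha)=1$, $d\alpha(R^\alpha,\cdot)=0$) and $\Lambda^\alpha$ the bivector field with $\Lambda^\alpha(\alpha,\cdot)=0$ and $\Lambda^\alpha(i_Yd\alpha,i_Zd\alpha)=d\alpha(Y,Z)$ for $Y,Z\in\ker\alpha$. We say that $(G,\alpha,F)$ *integrates* the Jacobi manifold $(M,\Lambda,R)$ if $t_*(\Lambda^\alpha)=\Lambda$ and $t_*(R^\alpha)=R$. It integrates the Poisson manifold $(M,\pi)$ if it integrates $(M,\pi,0)$. The *Reeb cocycle* of $(G,\alpha,F)$ is $r=\ln|F|$; it is a *coboundary* if $$r=s^*\kappa-t^*\kappa\qquad(\ast)$$ for some $\kappa\in C^\infty(M)$. **Proposition.** Let $(M,\Lambda,R)$ be a Jacobi manifold that is integrated by a co-oriented contact groupoid $(G,\alpha,F)$ whose Reeb cocycle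 is a coboundary. Then 1. all leaves of $(M,\Lambda,R)$ are even dimensional (in particular $\dim\big(\Lambda^\sharp(T_x^*M)+\mathbb{R}R_x\big)$ is even for every $x\in M$). Moreover, for every $\kappa\in C^\infty(M)$ satisfying $(\ast)$, 2. $e^{-\kappa}\Lambda$ is a Poisson bivector; 3. $(G,e^{t^*\kappa}\alpha,\mathrm{sgn}\,F)$ is a co-oriented contact groupoid that integrates the Poisson manifold $(M,e^{-\kappa}\Lambda)$; 4. if $R\equiv 0$, then $\kappa$ is a Casimir of the Poisson manifold $(M,\Lambda)$. -/

import Mathlib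

open Set Bundle Manifold
open scoped Manifold ContDiff Topology

universe u

noncomputable section

/-! Manifolds are smooth, without boundary, modelled on a finite-dimensional real normed space `E`
(through the model `𝓘(ℝ, E)`). -/

section Fields

variable {E : Type*} [NormedAddCommGroup E] [NormedSpace ℝ E]
  {M : Type*} [TopologicalSpace M] [ChartedSpace E M]

/-- The cotangent space `T*_x M`. -/
abbrev Cotangent (E : Type*) [NormedAddCommGroup E] [NormedSpace ℝ E]
    {M : Type*} [TopologicalSpace M] [ChartedSpace E M] (x : M) : Type _ :=
  TangentSpace 𝓘(ℝ, E) x →L[ℝ] ℝ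

/-- (Rough) vector fields on `M`. -/
abbrev VField (E : Type*) [NormedAddCommGroup E] [NormedSpace ℝ E]
    (M : Type*) [TopologicalSpace M] [ChartedSpace E M] : Type _ :=
  (x : M) → TangentSpace 𝓘(ℝ, E) x

/-- (Rough) 1-forms on `M`. -/
abbrev OneForm (E : Type*) [NormedAddCommGroup E] [NormedSpace ℝ E]
    (M : Type*) [TopologicalSpace M] [ChartedSpace E M] : Type _ :=
  (x : M) → Cotangent E x

/-- (Rough) contravariant 2-tensors on `M`, encoded by their sharp map `Λ♯ : T*M → TM`; the
associated bilinear form on covectors is `Λ(β, γ) = γ(Λ♯ β)`. Bivector fields are singled out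
by `IsBivectorField` below. -/
abbrev SharpField (E : Type*) [NormedAddCommGroup E] [NormedSpace ℝ E]
    (M : Type*) [TopologicalSpace M] [ChartedSpace E M] : Type _ :=
  (x : M) → Cotangent E x →ₗ[ℝ] TangentSpace 𝓘(ℝ, E) x

/-- `f ∈ C^∞(M)`. -/
abbrev SmoothFun (E : Type*) [NormedAddCommGroup E] [NormedSpace ℝ E]
    {M : Type*} [TopologicalSpace M] [ChartedSpace E M] (f : M → ℝ) : Prop :=
  ContMDiff 𝓘(ℝ, E) 𝓘(ℝ, ℝ) ∞ f

/-- The differential `df` of a real function, as a 1-form. -/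
abbrev dfun (E : Type*) [NormedAddCommGroup E] [NormedSpace ℝ E]
    {M : Type*} [TopologicalSpace M] [ChartedSpace E M] (f : M → ℝ) : OneForm E M :=
  mvfderiv 𝓘(ℝ, E) f

/-- Smooth vector fields: smooth sections of the tangent bundle. -/
def IsSmoothVField [IsManifold 𝓘(ℝ, E) ∞ M] (X : VField E M) : Prop :=
  ContMDiff 𝓘(ℝ, E) (𝓘(ℝ, E).prod 𝓘(ℝ, E)) ∞
    (fun x ↦ (⟨x, X x⟩ : TangentBundle 𝓘(ℝ, E) M))

/-- Smooth 1-forms: smooth sections of the cotangent bundle `Hom(TM, M × ℝ)`. -/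
def IsSmoothOneForm [IsManifold 𝓘(ℝ, E) ∞ M] (α : OneForm E M) : Prop :=
  ContMDiff 𝓘(ℝ, E) (𝓘(ℝ, E).prod 𝓘(ℝ, E →L[ℝ] ℝ)) ∞
    (fun x ↦ TotalSpace.mk' (E →L[ℝ] ℝ)
      (E := fun x : M ↦ TangentSpace 𝓘(ℝ, E) x →L[ℝ] Bundle.Trivial M ℝ x) x (α x))

/-- Smooth bivector fields: `Λ` is skew, and `Λ(df, dg)` is smooth for all `f, g ∈ C^∞(M)`
(on a Hausdorff manifold the latter is smoothness of the components of `Λ` in charts). -/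
structure IsBivectorField (Λ : SharpField E M) : Prop where
  skew : ∀ (x : M) (β : Cotangent E x), β (Λ x β) = 0
  smooth : ∀ f g : M → ℝ, SmoothFun E f → SmoothFun E g →
    SmoothFun E (fun x ↦ dfun E g x (Λ x (dfun E f x)))

/-- The expression of a 1-form in the preferred chart `φ` at `x`:
`y ↦ α_{φ⁻¹(y)} ∘ T_y φ⁻¹ ∈ E*` (meaningful for `y` in the target of `φ`). -/
def oneFormInChart (α : OneForm E M) (x : M) : E → E →L[ℝ] ℝ := fun y ↦
  (α ((extChartAt 𝓘(ℝ, E) x).symm y)).comp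
    (mfderiv 𝓘(ℝ, E) 𝓘(ℝ, E) (extChartAt 𝓘(ℝ, E) x).symm y)

/-- The exterior derivative of a 1-form, `(dα)_x(v, w)`, computed in the preferred chart at `x`.
(Tangent vectors at `x` are identified with elements of `E` in Mathlib through this same chart.)
The convention is `dα(X, Y) = X(α(Y)) - Y(α(X)) - α([X, Y])`. -/
def extDerivOneForm (α : OneForm E M) (x : M) (v w : TangentSpace 𝓘(ℝ, E) x) : ℝ :=
  fderiv ℝ (oneFormInChart α x) (extChartAt 𝓘(ℝ, E) x x) v w -
    fderiv ℝ (oneFormInChart α x) (extChartAt 𝓘(ℝ, E) x x) w v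

/-! ### Jacobi and Poisson structures -/

/-- The bracket `{f, g} = Λ(df, dg) + f R(g) - g R(f)` on `C^∞(M)`. -/
def jacobiBracket (Λ : SharpField E M) (R : VField E M) (f g : M → ℝ) : M → ℝ :=
  fun x ↦ dfun E g x (Λ x (dfun E f x)) + f x * dfun E g x (R x) - g x * dfun E f x (R x)

/-- `(M, Λ, R)` is a Jacobi manifold: `Λ` is a smooth bivector field and `R` a smooth vector field
such that `{f, g} = Λ(df, dg) + f R(g) - g R(f)` is a Lie bracket on `C^∞(M)`.
(Bilinearity, skew-symmetry and locality of this bracket are automatic.) -/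
structure IsJacobiManifold [IsManifold 𝓘(ℝ, E) ∞ M] (Λ : SharpField E M) (R : VField E M) :
    Prop where
  bivector : IsBivectorField Λ
  smooth_vfield : IsSmoothVField R
  jacobi : ∀ f g h : M → ℝ, SmoothFun E f → SmoothFun E g → SmoothFun E h → ∀ x : M,
    jacobiBracket Λ R f (jacobiBracket Λ R g h) x + jacobiBracket Λ R g (jacobiBracket Λ R h f) x
      + jacobiBracket Λ R h (jacobiBracket Λ R f g) x = 0

/-- The bracket `{f, g} = P(df, dg)` on `C^∞(M)`. -/
def poissonBracket (P : SharpField E M) (f g : M → ℝ) : M → ℝ :=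
  fun x ↦ dfun E g x (P x (dfun E f x))

/-- `P` is a Poisson bivector: a smooth bivector field such that `{f, g} = P(df, dg)` is a
Lie bracket on `C^∞(M)`. -/
structure IsPoissonBivector (P : SharpField E M) : Prop where
  bivector : IsBivectorField P
  jacobi : ∀ f g h : M → ℝ, SmoothFun E f → SmoothFun E g → SmoothFun E h → ∀ x : M,
    poissonBracket P f (poissonBracket P g h) x + poissonBracket P g (poissonBracket P h f) x
      + poissonBracket P h (poissonBracket P f g) x = 0

/-- `κ` is a Casimir of `P`: a smooth function with `P♯(dκ) = 0`. -/
def IsCasimir (P : SharpField E M) (κ : M → ℝ) : Prop :=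
  SmoothFun E κ ∧ ∀ x, P x (dfun E κ x) = 0

/-! ### The characteristic foliation of a Jacobi manifold -/

/-- The Hamiltonian vector field `X_f = Λ♯(df) + f R`. -/
def hamiltonianVField (Λ : SharpField E M) (R : VField E M) (f : M → ℝ) : VField E M :=
  fun x ↦ Λ x (dfun E f x) + f x • R x

/-- The characteristic distribution at `x`, spanned by the image of `Λ♯` and by `R`; equivalently
by the values at `x` of the Hamiltonian vector fields. It is the tangent space at `x` of the
leaf through `x`. -/
def charDist (Λ : SharpField E M) (R : VField E M) (x : M) : Submodule ℝ (TangentSpace 𝓘(ℝ, E) x) :=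
  LinearMap.range (Λ x) ⊔ Submodule.span ℝ {R x}

/-- `y` is reached from `x` along an integral curve of a Hamiltonian vector field. -/
def HamiltonianStep (Λ : SharpField E M) (R : VField E M) (x y : M) : Prop :=
  ∃ f : M → ℝ, SmoothFun E f ∧ ∃ γ : ℝ → M,
    IsMIntegralCurveOn (I := 𝓘(ℝ, E)) γ (hamiltonianVField Λ R f) (Icc 0 1) ∧ γ 0 = x ∧ γ 1 = y

/-- The leaf through `x`, as a set: the points reached from `x` along finitely many integral curves
of Hamiltonian vector fields. -/
def leafThrough (Λ : SharpField E M) (R : VField E M) (x : M) : Set M :=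
  {y | Relation.ReflTransGen (HamiltonianStep Λ R) x y}

/-- `ι : N → M`, with `N` a manifold modelled on `F`, is a leaf of the characteristic foliation of `(M, Λ, R)`, as an immersed manifold:
`N` is connected, `ι` is an injective immersion that is everywhere tangent to the
characteristic distribution, and its image is the whole leaf through some point. -/
structure IsLeaf (F : Type*) [NormedAddCommGroup F] [NormedSpace ℝ F]
    (Λ : SharpField E M) (R : VField E M)
    {N : Type*} [TopologicalSpace N] [ChartedSpace F N] (ι : N → M) : Prop where
  connected : ConnectedSpace N
  smooth : ContMDiff 𝓘(ℝ, F) 𝓘(ℝ, E) ∞ ι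
  injective : Function.Injective ι
  immersion : ∀ p : N, Function.Injective (mfderiv 𝓘(ℝ, F) 𝓘(ℝ, E) ι p)
  tangent : ∀ p : N,
    LinearMap.range (mfderiv 𝓘(ℝ, F) 𝓘(ℝ, E) ι p).toLinearMap = charDist Λ R (ι p)
  range_eq : ∃ x : M, range ι = leafThrough Λ R x

/-! ### Contact forms -/

/-- `α` is a contact form: a smooth nowhere vanishing 1-form such that `dα` is
non-degenerate on the hyperplane distribution `H = ker α`. (For `X, Y ∈ Γ(H)` one has
`α([X, Y]) = -dα(X, Y)`, so this is non-degeneracy of `(X, Y) ↦ [X, Y] mod H`.) -/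
structure IsContactForm [IsManifold 𝓘(ℝ, E) ∞ M] (α : OneForm E M) : Prop where
  smooth : IsSmoothOneForm α
  ne_zero : ∀ x, α x ≠ 0
  nondegenerate : ∀ (x : M) (v : TangentSpace 𝓘(ℝ, E) x), α x v = 0 →
    (∀ w : TangentSpace 𝓘(ℝ, E) x, α x w = 0 → extDerivOneForm α x v w = 0) → v = 0

/-- `R` is the Reeb vector field of the contact form `α`: `α(R) = 1` and `dα(R, -) = 0`.
(These equations determine `R`.) -/
structure IsReebVField (α : OneForm E M) (R : VField E M) : Prop where
  apply_eq_one : ∀ x, α x (R x) = 1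
  extDeriv_eq_zero : ∀ (x : M) (w : TangentSpace 𝓘(ℝ, E) x), extDerivOneForm α x (R x) w = 0

/-- `Λ` is the bivector field of the contact form `α`: it is skew, `Λ(α, -) = 0`, and on
`H* = {i_v dα | v ∈ H}` it is the inverse of `dα` on `H`, i.e. the form that
corresponds to `dα|_H` under the isomorphism `H → H*`, `v ↦ i_v dα`. (These conditions determine
`Λ`. With `Λ(β, γ) = γ(Λ♯ β)` they give `dα(Λ♯ β, w) = -β(w)` for `w ∈ H`, the sign for
which `Λ(df, dg) + f R(g) - g R(f)` is the Jacobi bracket of `α`.) -/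
structure IsContactBivector (α : OneForm E M) (Λ : SharpField E M) : Prop where
  skew : ∀ (x : M) (β : Cotangent E x), β (Λ x β) = 0
  apply_form : ∀ x, Λ x (α x) = 0
  inverse : ∀ (x : M) (v w : TangentSpace 𝓘(ℝ, E) x), α x v = 0 → α x w = 0 →
    ∀ β γ : Cotangent E x, (∀ z, β z = extDerivOneForm α x v z) →
      (∀ z, γ z = extDerivOneForm α x w z) → γ (Λ x β) = extDerivOneForm α x v w

end Fields

/-! ### Lie groupoids and contact groupoids -/

section Groupoids

variable {E₀ : Type*} [NormedAddCommGroup E₀] [NormedSpace ℝ E₀]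
  {M : Type*} [TopologicalSpace M] [ChartedSpace E₀ M]
  {E₁ : Type*} [NormedAddCommGroup E₁] [NormedSpace ℝ E₁]
  {G : Type*} [TopologicalSpace G] [ChartedSpace E₁ G]

/-- A Lie groupoid `G ⇉ M`. The arrows `g, h` are composable when `s g = t h`; the value
`mul g h` is meaningless otherwise. Since `s` and `t` are submersions, the set of composable pairs is
an embedded submanifold of `G × G`, and smoothness of the multiplication on it is `ContMDiffOn`. -/
structure LieGroupoid (E₀ : Type*) [NormedAddCommGroup E₀] [NormedSpace ℝ E₀]
    (M : Type*) [TopologicalSpace M] [ChartedSpace E₀ M]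
    (E₁ : Type*) [NormedAddCommGroup E₁] [NormedSpace ℝ E₁]
    (G : Type*) [TopologicalSpace G] [ChartedSpace E₁ G] where
  /-- source -/
  s : G → M
  /-- target -/
  t : G → M
  /-- unit -/
  u : M → G
  /-- inversion -/
  inv : G → G
  /-- multiplication -/
  mul : G → G → G
  s_unit : ∀ x, s (u x) = x
  t_unit : ∀ x, t (u x) = x
  s_mul : ∀ g h, s g = t h → s (mul g h) = s h
  t_mul : ∀ g h, s g = t h → t (mul g h) = t g
  mul_assoc : ∀ g h k, s g = t h → s h = t k → mul (mul g h) k = mul g (mul h k)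
  unit_mul : ∀ g, mul (u (t g)) g = g
  mul_unit : ∀ g, mul g (u (s g)) = g
  s_inv : ∀ g, s (inv g) = t g
  t_inv : ∀ g, t (inv g) = s g
  inv_mul : ∀ g, mul (inv g) g = u (s g)
  mul_inv : ∀ g, mul g (inv g) = u (t g)
  smooth_s : ContMDiff 𝓘(ℝ, E₁) 𝓘(ℝ, E₀) ∞ s
  smooth_t : ContMDiff 𝓘(ℝ, E₁) 𝓘(ℝ, E₀) ∞ t
  smooth_u : ContMDiff 𝓘(ℝ, E₀) 𝓘(ℝ, E₁) ∞ u
  smooth_inv : ContMDiff 𝓘(ℝ, E₁) 𝓘(ℝ, E₁) ∞ inv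
  submersion_s : ∀ g, Function.Surjective (mfderiv 𝓘(ℝ, E₁) 𝓘(ℝ, E₀) s g)
  submersion_t : ∀ g, Function.Surjective (mfderiv 𝓘(ℝ, E₁) 𝓘(ℝ, E₀) t g)
  smooth_mul : ContMDiffOn (𝓘(ℝ, E₁).prod 𝓘(ℝ, E₁)) 𝓘(ℝ, E₁) ∞ (fun p : G × G ↦ mul p.1 p.2)
    {p : G × G | s p.1 = t p.2}

/-- The multiplication `dm(X, Y)` of the tangent groupoid `TG ⇉ TM`, where `X` and `Y` are tangent
vectors with `ds(X) = dt(Y)`. (Every derivative of `m` within the set of composable pairs has the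
same restriction to the tangent space of this submanifold.) -/
def LieGroupoid.tangentMul (𝒢 : LieGroupoid E₀ M E₁ G) (X Y : TangentBundle 𝓘(ℝ, E₁) G) :
    TangentSpace 𝓘(ℝ, E₁) (𝒢.mul X.1 Y.1) :=
  mfderivWithin (𝓘(ℝ, E₁).prod 𝓘(ℝ, E₁)) 𝓘(ℝ, E₁) (fun p : G × G ↦ 𝒢.mul p.1 p.2)
    {p : G × G | 𝒢.s p.1 = 𝒢.t p.2} (X.1, Y.1) (X.2, Y.2)

/-- `(G, α, F)` is a co-oriented contact groupoid: `α` is a contact form on `G`,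
`F : G → ℝ^*` is a morphism of Lie groupoids, and `α` is `F`-multiplicative,
`m^*α = pr₁^*α + pr₁^*(F) pr₂^*α`. -/
structure IsCoorientedContactGroupoid [IsManifold 𝓘(ℝ, E₁) ∞ G]
    (𝒢 : LieGroupoid E₀ M E₁ G) (α : OneForm E₁ G) (F : G → ℝ) : Prop where
  contact : IsContactForm α
  smooth_F : SmoothFun E₁ F
  F_ne_zero : ∀ g, F g ≠ 0
  F_mul : ∀ g h, 𝒢.s g = 𝒢.t h → F (𝒢.mul g h) = F g * F h
  multiplicative : ∀ X Y : TangentBundle 𝓘(ℝ, E₁) G,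
    tangentMap 𝓘(ℝ, E₁) 𝓘(ℝ, E₀) 𝒢.s X = tangentMap 𝓘(ℝ, E₁) 𝓘(ℝ, E₀) 𝒢.t Y →
    α (𝒢.mul X.1 Y.1) (𝒢.tangentMul X Y) = α X.1 X.2 + F X.1 * α Y.1 Y.2

/-- The co-oriented contact groupoid `(G, α, F)` integrates the Jacobi manifold `(M, Λ, R)`:
the target map is a Jacobi map `(G, Λ^α, R^α) → (M, Λ, R)` (with bundle component `1`), that is,
`t_*(Λ^α) = Λ` and `t_*(R^α) = R`. -/
structure Integrates [IsManifold 𝓘(ℝ, E₀) ∞ M] [IsManifold 𝓘(ℝ, E₁) ∞ G]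
    (𝒢 : LieGroupoid E₀ M E₁ G) (α : OneForm E₁ G) (F : G → ℝ)
    (Λ : SharpField E₀ M) (R : VField E₀ M) : Prop where
  contact_groupoid : IsCoorientedContactGroupoid 𝒢 α F
  jacobi_manifold : IsJacobiManifold Λ R
  jacobi_map : ∃ (Λα : SharpField E₁ G) (Rα : VField E₁ G),
    IsContactBivector α Λα ∧ IsReebVField α Rα ∧
    (∀ (g : G) (β : Cotangent E₀ (𝒢.t g)),
      mfderiv 𝓘(ℝ, E₁) 𝓘(ℝ, E₀) 𝒢.t g
        (Λα g (β.comp (mfderiv 𝓘(ℝ, E₁) 𝓘(ℝ, E₀) 𝒢.t g))) = Λ (𝒢.t g) β) ∧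
    (∀ g : G, mfderiv 𝓘(ℝ, E₁) 𝓘(ℝ, E₀) 𝒢.t g (Rα g) = R (𝒢.t g))

/-- The Reeb cocycle `r = ln |F|`. -/
def reebCocycle (F : G → ℝ) : G → ℝ := fun g ↦ Real.log |F g|

/-- `κ ∈ C^∞(M)` and the function `r` on `G` is the coboundary `s^*κ - t^*κ`. -/
def IsPrimitive (𝒢 : LieGroupoid E₀ M E₁ G) (r : G → ℝ) (κ : M → ℝ) : Prop :=
  SmoothFun E₀ κ ∧ ∀ g, r g = κ (𝒢.s g) - κ (𝒢.t g)

end Groupoids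

end

/-! ### Skew forms have even rank -/

/-! Everything follows from the identity `R = Λ♯(dκ)` for a primitive κ of the Reeb cocycle.

To obtain it, put `f = e^{t^*κ}` and replace `α` by `fα`. Since `e^{t^*κ} F = sgn(F) e^{s^*κ}`, the
new form is multiplicative with the locally constant cocycle `sgn F`
(`IsCoorientedContactGroupoid.smul_sign`). For a locally constant cocycle, `dα` is itself
multiplicative up to sign, which forces its kernel, the Reeb direction, into the target fibres
(`IsCoorientedContactGroupoid.mfderiv_t_eq_zero`). The Reeb field of `fα` is `f⁻¹(R^α - f⁻¹
Λ^α♯(df))` (`IsReebVField.smul`), and `df = f t^*dκ`. Its push-forward by `t` is therefore `e^{-κ}(R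
- Λ♯(dκ))`, which must vanish.

Given the identity, the characteristic distribution is the image of the skew map `Λ♯`, hence even
dimensional. Multiplication by `e^{-κ}` carries the bracket of `e^{-κ}Λ` to the Jacobi bracket, so
`e^{-κ}Λ` is Poisson. The rescaled groupoid integrates it because its bivector is `f⁻¹Λ^α` and its
Reeb field projects to zero. Finally, `R = 0` says `Λ♯(dκ) = 0`. -/

theorem LinearMap.BilinForm.even_finrank_of_nondegenerate_of_isAlt
    {W : Type*} [AddCommGroup W] [Module ℝ W] [FiniteDimensional ℝ W]
    (B : LinearMap.BilinForm ℝ W) (hB : B.Nondegenerate) (hA : B.IsAlt) :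
    Even (Module.finrank ℝ W) := by
  let b := Module.finBasis ℝ W
  have hdet := (LinearMap.BilinForm.nondegenerate_iff_det_ne_zero (B := B) b).1 hB
  have hT : (LinearMap.BilinForm.toMatrix b B).transpose = -(LinearMap.BilinForm.toMatrix b B) := by
    ext i j
    simp [LinearMap.BilinForm.toMatrix_apply, hA.neg_eq]
  by_contra hodd
  rw [Nat.not_even_iff_odd] at hodd
  -- In odd size, `Bᵀ = -B` gives `det B = -det B`.
  have h := congrArg Matrix.det hT
  rw [Matrix.det_transpose, Matrix.det_neg, Fintype.card_fin, hodd.neg_one_pow] at h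
  exact hdet (by linarith)

/-- The image of a skew map carries the symplectic form `ω(Λβ, Λγ) = β(Λγ)`, as on the leaves of a
Poisson manifold. -/
theorem even_finrank_range_of_skew {V : Type*} [NormedAddCommGroup V] [NormedSpace ℝ V]
    [FiniteDimensional ℝ V] (Λ : (V →L[ℝ] ℝ) →ₗ[ℝ] V) (h : ∀ β : V →L[ℝ] ℝ, β (Λ β) = 0) :
    Even (Module.finrank ℝ (LinearMap.range Λ)) := by
  have hskew : ∀ β γ : V →L[ℝ] ℝ, γ (Λ β) = -β (Λ γ) := fun β γ ↦ by
    have := h (β + γ)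
    simp only [map_add, _root_.add_apply, h] at this
    linarith
  obtain ⟨j, hj⟩ := Λ.rangeRestrict.exists_rightInverse_of_surjective Λ.range_rangeRestrict
  have hj' : ∀ w : LinearMap.range Λ, Λ (j w) = w := fun w ↦
    congrArg Subtype.val (LinearMap.congr_fun hj w)
  -- The linear section `j` chooses a covector β over each vector `Λβ`; by skewness `β(Λγ) = -γ(Λβ)`
  -- does not depend on the choice.
  let B : LinearMap.BilinForm ℝ (LinearMap.range Λ) :=
    LinearMap.mk₂ ℝ (fun w w' ↦ j w (w' : V)) (by simp) (by simp) (by simp) (by simp)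
  have hAlt : B.IsAlt := fun w ↦ by
    change j w (w : V) = 0
    simpa only [hj'] using h (j w)
  refine B.even_finrank_of_nondegenerate_of_isAlt ?_ hAlt
  refine (LinearMap.IsRefl.nondegenerate_iff_separatingLeft hAlt.isRefl).2 fun w hw ↦ ?_
  by_contra hne
  obtain ⟨β, hβ⟩ := SeparatingDual.exists_ne_zero (R := ℝ) (x := (w : V)) (by simpa using hne)
  have h1 : j w (Λ β) = 0 := hw ⟨Λ β, β, rfl⟩
  rw [hskew, hj'] at h1
  exact hβ (by linarith)

/-! ### Exterior derivative of 1-forms: charts, Leibniz rule, naturality -/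

section OneForms

variable {E : Type*} [NormedAddCommGroup E] [NormedSpace ℝ E]
  {M : Type*} [TopologicalSpace M] [ChartedSpace E M] [IsManifold 𝓘(ℝ, E) ∞ M]

/-- Smoothness is given in bundle trivializations, while `oneFormInChart` uses the derivative of the
inverse chart. The two agree near the base point, because the trivialization of the tangent bundle
is that derivative. -/
theorem IsSmoothOneForm.differentiableAt_inChart {α : OneForm E M} (hα : IsSmoothOneForm α)
    (x : M) : DifferentiableAt ℝ (oneFormInChart α x) (extChartAt 𝓘(ℝ, E) x x) := by
  have h := ((contMDiffAt_hom_bundle _).1 (hα x)).2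
  have hs : ContMDiffAt 𝓘(ℝ, E) 𝓘(ℝ, E) ∞ (extChartAt 𝓘(ℝ, E) x).symm
      (extChartAt 𝓘(ℝ, E) x x) :=
    (contMDiffOn_extChartAt_symm x).contMDiffAt (extChartAt_target_mem_nhds x)
  have hc := ContMDiffAt.comp_of_eq h hs (extChartAt_to_inv x)
  have hd := (hc.contDiffAt).differentiableAt (by simp)
  refine hd.congr_of_eventuallyEq ?_
  filter_upwards [extChartAt_target_mem_nhds (I := 𝓘(ℝ, E)) x] with y hy
  have hy' : (extChartAt 𝓘(ℝ, E) x).symm y ∈ (chartAt E x).source := by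
    simpa using (extChartAt 𝓘(ℝ, E) x).map_target hy
  have h2 : Trivialization.symmL ℝ (trivializationAt E (TangentSpace 𝓘(ℝ, E)) x)
        ((extChartAt 𝓘(ℝ, E) x).symm y) =
      mfderiv 𝓘(ℝ, E) 𝓘(ℝ, E) (extChartAt 𝓘(ℝ, E) x).symm y := by
    have h3 := TangentBundle.symmL_trivializationAt (I := 𝓘(ℝ, E)) hy'
    rw [(extChartAt 𝓘(ℝ, E) x).right_inv hy, ModelWithCorners.range_eq_univ,
      mfderivWithin_univ] at h3
    exact h3
  have h4 : ∀ (z : M) (c : ℝ), (Trivialization.continuousLinearMapAt ℝ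
      (trivializationAt ℝ (Trivial M ℝ) x) z) c = c := by simp
  simp only [oneFormInChart, Function.comp, ContinuousLinearMap.inCoordinates]
  ext v
  simp only [ContinuousLinearMap.comp_apply]
  rw [h4]
  exact (congrArg (fun L : E →L[ℝ] E ↦ α ((extChartAt 𝓘(ℝ, E) x).symm y) (L v)) h2).symm

omit [IsManifold 𝓘(ℝ, E) ∞ M] in
theorem OneForm.apply_congr (α : OneForm E M) {x y : M} (h : x = y) (u : E) :
    (α x : E →L[ℝ] ℝ) u = (α y : E →L[ℝ] ℝ) u := by
  subst h; rfl

theorem mfderiv_extChartAt_symm_self (x : M) :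
    (mfderiv 𝓘(ℝ, E) 𝓘(ℝ, E) (extChartAt 𝓘(ℝ, E) x).symm (extChartAt 𝓘(ℝ, E) x x) : E →L[ℝ] E) =
      ContinuousLinearMap.id ℝ E := by
  have : IsManifold 𝓘(ℝ, E) 1 M := .of_le (n := ∞) (by simp)
  have h := mfderivWithin_range_extChartAt_symm (I := 𝓘(ℝ, E)) (x := x)
  rw [ModelWithCorners.range_eq_univ, mfderivWithin_univ] at h
  exact h

theorem oneFormInChart_self (α : OneForm E M) (x : M) (v : E) :
    oneFormInChart α x (extChartAt 𝓘(ℝ, E) x x) v = (α x : E →L[ℝ] ℝ) v := by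
  have h := mfderiv_extChartAt_symm_self (E := E) x
  refine (congrArg (fun L : E →L[ℝ] E ↦ (α ((extChartAt 𝓘(ℝ, E) x).symm
    (extChartAt 𝓘(ℝ, E) x x)) : E →L[ℝ] ℝ) (L v)) h).trans ?_
  exact α.apply_congr (extChartAt_to_inv x) v

/-- `d(fα) = f dα + df ∧ α`. -/
theorem extDerivOneForm_smul {α : OneForm E M} (hα : IsSmoothOneForm α) {f : M → ℝ}
    (hf : SmoothFun E f) (x : M) (v w : TangentSpace 𝓘(ℝ, E) x) :
    extDerivOneForm (fun x ↦ f x • α x) x v w =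
      f x * extDerivOneForm α x v w + (dfun E f x v * α x w - dfun E f x w * α x v) := by
  set φ := extChartAt 𝓘(ℝ, E) x
  have hA := (hα.differentiableAt_inChart x).hasFDerivAt
  have hs : ContMDiffAt 𝓘(ℝ, E) 𝓘(ℝ, E) ∞ φ.symm (φ x) :=
    (contMDiffOn_extChartAt_symm x).contMDiffAt (extChartAt_target_mem_nhds x)
  have hx : φ.symm (φ x) = x := extChartAt_to_inv x
  have hd : HasFDerivAt (f ∘ φ.symm) (dfun E f x : E →L[ℝ] ℝ) (φ x) := by
    have h1 := (hf.mdifferentiableAt (x := φ.symm (φ x)) (by simp)).hasMFDerivAt.comp (φ x)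
      (hs.mdifferentiableAt (by simp)).hasMFDerivAt
    have h2 := h1.hasFDerivAt
    refine h2.congr_fderiv (ContinuousLinearMap.ext fun v ↦ Eq.symm ?_)
    have h3 := mfderiv_extChartAt_symm_self (E := E) x
    refine (OneForm.apply_congr (dfun E f) hx.symm v).trans ?_
    exact (congrArg (fun L : E →L[ℝ] E ↦ (dfun E f (φ.symm (φ x)) : E →L[ℝ] ℝ) (L v)) h3).symm
  have hprod := hd.smul hA
  have heq : oneFormInChart (fun x ↦ f x • α x) x = (f ∘ φ.symm) • oneFormInChart α x := by
    ext y v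
    rfl
  have key : ∀ a b : E, fderiv ℝ (oneFormInChart (fun x ↦ f x • α x) x) (φ x) a b =
      f x * fderiv ℝ (oneFormInChart α x) (φ x) a b
        + (dfun E f x : E →L[ℝ] ℝ) a * (α x : E →L[ℝ] ℝ) b := by
    intro a b
    rw [heq, hprod.fderiv]
    have := oneFormInChart_self α x b
    change f (φ.symm (φ x)) * fderiv ℝ (oneFormInChart α x) (φ x) a b +
      (dfun E f x : E →L[ℝ] ℝ) a * oneFormInChart α x (φ x) b = _
    rw [hx]
    exact congrArg (fun c ↦ f x * fderiv ℝ (oneFormInChart α x) (φ x) a b +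
      (dfun E f x : E →L[ℝ] ℝ) a * c) this
  have h1 := key v w
  have h2 := key w v
  simp only [extDerivOneForm]
  linear_combination h1 - h2

section Pullback

variable {E' : Type*} [NormedAddCommGroup E'] [NormedSpace ℝ E']

/-- The pullback of a 1-form by a map defined on a normed space. -/
noncomputable def OneForm.pullback (α : OneForm E M) (f : E' → M) : E' → E' →L[ℝ] ℝ := fun y ↦
  (α (f y)).comp (mfderiv 𝓘(ℝ, E') 𝓘(ℝ, E) f y)

/-- In the chart at `f y₀` the pullback becomes a composition of maps between normed spaces, to
which the product rule applies. -/
theorem OneForm.pullback_eventuallyEq (α : OneForm E M) {f : E' → M} {y₀ : E'}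
    (hf : ContMDiffAt 𝓘(ℝ, E') 𝓘(ℝ, E) 2 f y₀) :
    α.pullback f =ᶠ[𝓝 y₀] fun y ↦ (oneFormInChart α (f y₀) (extChartAt 𝓘(ℝ, E) (f y₀) (f y))).comp
      (fderiv ℝ (extChartAt 𝓘(ℝ, E) (f y₀) ∘ f) y) := by
  have : IsManifold 𝓘(ℝ, E) 2 M := .of_le (n := ∞) (by decide)
  have : IsManifold 𝓘(ℝ, E) 1 M := .of_le (n := ∞) (by simp)
  have h1 := (contMDiffAt_iff_contMDiffAt_nhds (by decide)).1 hf
  have h2 := hf.continuousAt.preimage_mem_nhds (extChartAt_source_mem_nhds (I := 𝓘(ℝ, E)) (f y₀))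
  filter_upwards [h1, h2] with y hy hy2
  have hc : mfderiv 𝓘(ℝ, E') 𝓘(ℝ, E) (extChartAt 𝓘(ℝ, E) (f y₀) ∘ f) y = _ :=
    mfderiv_comp y ((contMDiffAt_extChartAt' (I := 𝓘(ℝ, E)) (n := 2)
      (by simpa using hy2)).mdifferentiableAt (by simp)) (hy.mdifferentiableAt (by simp))
  have hi := mfderivWithin_extChartAt_symm_comp_mfderiv_extChartAt' (I := 𝓘(ℝ, E)) hy2
  ext v
  have h3 : fderiv ℝ (extChartAt 𝓘(ℝ, E) (f y₀) ∘ f) y v =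
      mfderiv 𝓘(ℝ, E) 𝓘(ℝ, E) (extChartAt 𝓘(ℝ, E) (f y₀)) (f y)
        (mfderiv 𝓘(ℝ, E') 𝓘(ℝ, E) f y v) := by
    rw [← mfderiv_eq_fderiv]
    exact congrArg (fun L : E' →L[ℝ] E ↦ L v) hc
  rw [ModelWithCorners.range_eq_univ, mfderivWithin_univ] at hi
  have h4 := congrArg (fun L : E →L[ℝ] E ↦ L (mfderiv 𝓘(ℝ, E') 𝓘(ℝ, E) f y v)) hi
  refine ((α.apply_congr ((extChartAt 𝓘(ℝ, E) (f y₀)).left_inv hy2) _).symm.trans ?_)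
  refine (congrArg (fun u : E ↦ (α ((extChartAt 𝓘(ℝ, E) (f y₀)).symm
    (extChartAt 𝓘(ℝ, E) (f y₀) (f y))) : E →L[ℝ] ℝ) u) h4).symm.trans ?_
  rw [ContinuousLinearMap.comp_apply, h3]
  rfl

/-- Naturality of `d`. The product rule leaves a term in the second derivative of `f`, which is
symmetric and drops out on antisymmetrizing; this is why class `C²` is needed and enough. -/
theorem IsSmoothOneForm.extDeriv_pullback {α : OneForm E M} (hα : IsSmoothOneForm α) {f : E' → M}
    {y₀ : E'} (hf : ContMDiffAt 𝓘(ℝ, E') 𝓘(ℝ, E) 2 f y₀) :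
    DifferentiableAt ℝ (α.pullback f) y₀ ∧ ∀ v w : E',
      fderiv ℝ (α.pullback f) y₀ v w - fderiv ℝ (α.pullback f) y₀ w v =
        extDerivOneForm α (f y₀) (mfderiv 𝓘(ℝ, E') 𝓘(ℝ, E) f y₀ v)
          (mfderiv 𝓘(ℝ, E') 𝓘(ℝ, E) f y₀ w) := by
  have : IsManifold 𝓘(ℝ, E) 2 M := .of_le (n := ∞) (by decide)
  have : IsManifold 𝓘(ℝ, E) 1 M := .of_le (n := ∞) (by simp)
  set φ := extChartAt 𝓘(ℝ, E) (f y₀)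
  have hφ : ContMDiffAt 𝓘(ℝ, E) 𝓘(ℝ, E) 2 φ (f y₀) := contMDiffAt_extChartAt
  have hF : ContDiffAt ℝ 2 (φ ∘ f) y₀ := (hφ.comp y₀ hf).contDiffAt
  have hF1 : HasFDerivAt (φ ∘ f) (fderiv ℝ (φ ∘ f) y₀) y₀ :=
    (hF.differentiableAt (by simp)).hasFDerivAt
  have hF2 : HasFDerivAt (fderiv ℝ (φ ∘ f)) (fderiv ℝ (fderiv ℝ (φ ∘ f)) y₀) y₀ :=
    ((hF.fderiv_right (m := 1) (by norm_num)).differentiableAt (by simp)).hasFDerivAt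
  have hsymm : IsSymmSndFDerivAt ℝ (φ ∘ f) y₀ := hF.isSymmSndFDerivAt (by simp)
  have hA := (hα.differentiableAt_inChart (f y₀)).hasFDerivAt
  have hAF := hA.comp y₀ hF1
  have hprod := (hAF.clm_comp hF2).congr_of_eventuallyEq (α.pullback_eventuallyEq hf)
  have hder : (fderiv ℝ (φ ∘ f) y₀ : E' →L[ℝ] E) = mfderiv 𝓘(ℝ, E') 𝓘(ℝ, E) f y₀ := by
    have hc : mfderiv 𝓘(ℝ, E') 𝓘(ℝ, E) (φ ∘ f) y₀ = _ :=
      mfderiv_comp y₀ (hφ.mdifferentiableAt (by simp)) (hf.mdifferentiableAt (by simp))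
    rw [mfderiv_extChartAt_self] at hc
    rw [← mfderiv_eq_fderiv]
    exact hc
  refine ⟨hprod.differentiableAt, fun v w ↦ ?_⟩
  rw [hprod.fderiv]
  have hs := hsymm v w
  simp only [_root_.add_apply, ContinuousLinearMap.comp_apply, ContinuousLinearMap.compL_apply,
    ContinuousLinearMap.flip_apply]
  rw [hs, hder]
  simp only [extDerivOneForm]
  exact add_sub_add_left_eq_sub _ _ _

end Pullback

end OneForms

/-! ### Local sections of a submersion -/

section LocalSections

theorem ContinuousLinearMap.exists_rightInverse_apply_eq {V W : Type*} [NormedAddCommGroup V]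
    [NormedSpace ℝ V] [NormedAddCommGroup W] [NormedSpace ℝ W] [FiniteDimensional ℝ W]
    (T : V →L[ℝ] W) (hT : Function.Surjective T) {v : V} (hv : T v ≠ 0) :
    ∃ L : W →L[ℝ] V, (∀ w, T (L w) = w) ∧ L (T v) = v := by
  obtain ⟨L₀, hL₀⟩ := T.toLinearMap.exists_rightInverse_of_surjective (LinearMap.range_eq_top.2 hT)
  have hL₀' : ∀ w, T (L₀ w) = w := fun w ↦ LinearMap.congr_fun hL₀ w
  obtain ⟨ψ, hψ⟩ := SeparatingDual.exists_eq_one (R := ℝ) hv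
  -- The rank-one correction takes values in `ker T`, so the sum is still a right inverse, and `ψ (T
  -- v) = 1` moves the value at `T v` to `v`.
  refine ⟨L₀.toContinuousLinearMap + ψ.smulRight (v - L₀ (T v)), fun w ↦ ?_, ?_⟩
  · simp [hL₀']
  · simp [hψ]

variable {E₀ : Type*} [NormedAddCommGroup E₀] [NormedSpace ℝ E₀] [FiniteDimensional ℝ E₀]
  {M : Type*} [TopologicalSpace M] [ChartedSpace E₀ M] [IsManifold 𝓘(ℝ, E₀) ∞ M]
  {E₁ : Type*} [NormedAddCommGroup E₁] [NormedSpace ℝ E₁]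
  {G : Type*} [TopologicalSpace G] [ChartedSpace E₁ G] [IsManifold 𝓘(ℝ, E₁) ∞ G]

/-- A submersion has, through every point, a local section whose derivative takes a prescribed
non-vertical tangent vector as a value. -/
theorem exists_local_section {t : G → M} (ht : ContMDiff 𝓘(ℝ, E₁) 𝓘(ℝ, E₀) ∞ t) (g : G)
    (hsurj : Function.Surjective (mfderiv 𝓘(ℝ, E₁) 𝓘(ℝ, E₀) t g)) (v : TangentSpace 𝓘(ℝ, E₁) g)
    (hv : mfderiv 𝓘(ℝ, E₁) 𝓘(ℝ, E₀) t g v ≠ 0) :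
    ∃ σ : M → G, σ (t g) = g ∧ ContMDiffAt 𝓘(ℝ, E₀) 𝓘(ℝ, E₁) 2 σ (t g) ∧
      (∀ᶠ x in 𝓝 (t g), t (σ x) = x) ∧
      (mfderiv 𝓘(ℝ, E₀) 𝓘(ℝ, E₁) σ (t g) : E₀ →L[ℝ] E₁)
        (mfderiv 𝓘(ℝ, E₁) 𝓘(ℝ, E₀) t g v) = v := by
  have : IsManifold 𝓘(ℝ, E₀) 2 M := .of_le (n := ∞) (by decide)
  have : IsManifold 𝓘(ℝ, E₁) 2 G := .of_le (n := ∞) (by decide)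
  have : IsManifold 𝓘(ℝ, E₀) 1 M := .of_le (n := ∞) (by decide)
  have : CompleteSpace E₀ := FiniteDimensional.complete ℝ E₀
  set φ := extChartAt 𝓘(ℝ, E₁) g with hφ
  set ψ := extChartAt 𝓘(ℝ, E₀) (t g) with hψ
  obtain ⟨L, hL, hLv⟩ := ContinuousLinearMap.exists_rightInverse_apply_eq
    (V := E₁) (W := E₀) (mfderiv 𝓘(ℝ, E₁) 𝓘(ℝ, E₀) t g) hsurj (v := v) hv
  -- An affine slice through `g` in the chart, transverse to the fibre of `t` and tangent to `v`.
  let h : E₀ → G := fun z ↦ φ.symm (φ g + L z)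
  have hh0 : h 0 = g := by simp [h, hφ]
  have haff : ContMDiffAt 𝓘(ℝ, E₀) 𝓘(ℝ, E₁) 2 (fun z ↦ φ g + L z) 0 :=
    (contDiffAt_const.add L.contDiff.contDiffAt).contMDiffAt
  have haff' : HasMFDerivAt 𝓘(ℝ, E₀) 𝓘(ℝ, E₁) (fun z ↦ φ g + L z) 0 L :=
    (L.hasFDerivAt.const_add (φ g)).hasMFDerivAt
  have hsymm : ContMDiffAt 𝓘(ℝ, E₁) 𝓘(ℝ, E₁) 2 φ.symm (φ g) :=
    (contMDiffOn_extChartAt_symm g).contMDiffAt (extChartAt_target_mem_nhds g)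
  have hsymm' : HasMFDerivAt 𝓘(ℝ, E₁) 𝓘(ℝ, E₁) φ.symm (φ g) (ContinuousLinearMap.id ℝ E₁) := by
    have h1 := (hsymm.mdifferentiableAt (by simp)).hasMFDerivAt
    have h2 := mfderiv_extChartAt_symm_self (E := E₁) g
    exact h2 ▸ h1
  have hψc : ContMDiffAt 𝓘(ℝ, E₀) 𝓘(ℝ, E₀) 2 ψ (t g) := contMDiffAt_extChartAt
  have hψ' : HasMFDerivAt 𝓘(ℝ, E₀) 𝓘(ℝ, E₀) ψ (t g) (ContinuousLinearMap.id ℝ E₀) := by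
    have h1 := (hψc.mdifferentiableAt (by simp)).hasMFDerivAt
    have h2 := mfderiv_extChartAt_self (I := 𝓘(ℝ, E₀)) (x := t g)
    exact h2 ▸ h1
  have h00 : φ g + L 0 = φ g := by simp
  have hh : ContMDiffAt 𝓘(ℝ, E₀) 𝓘(ℝ, E₁) 2 h 0 := hsymm.comp_of_eq haff h00
  have hh' : HasMFDerivAt 𝓘(ℝ, E₀) 𝓘(ℝ, E₁) h 0 L := by
    have h1 : HasMFDerivAt 𝓘(ℝ, E₁) 𝓘(ℝ, E₁) φ.symm (φ g + L 0) (ContinuousLinearMap.id ℝ E₁) :=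
      h00.symm ▸ hsymm'
    exact h1.comp 0 haff'
  -- Along the slice, `t` has derivative `dt ∘ L = id`. It is therefore locally invertible, and the
  -- slice reparametrized by the inverse is the section.
  let k : E₀ → E₀ := fun z ↦ ψ (t (h z))
  have hk : ContDiffAt ℝ 2 k 0 := by
    have h1 := (ht.of_le (m := 2) (by decide) |>.contMDiffAt (x := g)).comp_of_eq hh hh0
    exact (hψc.comp_of_eq h1 (congrArg t hh0)).contDiffAt
  have hk' : HasFDerivAt k ((ContinuousLinearEquiv.refl ℝ E₀ : E₀ ≃L[ℝ] E₀) : E₀ →L[ℝ] E₀) 0 := by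
    have h1 : HasMFDerivAt 𝓘(ℝ, E₁) 𝓘(ℝ, E₀) t (h 0)
        (mfderiv 𝓘(ℝ, E₁) 𝓘(ℝ, E₀) t g : E₁ →L[ℝ] E₀) := by
      rw [hh0]
      exact (ht.mdifferentiableAt (by simp)).hasMFDerivAt
    have h2 : HasMFDerivAt 𝓘(ℝ, E₀) 𝓘(ℝ, E₀) ψ (t (h 0)) (ContinuousLinearMap.id ℝ E₀) := by
      rw [hh0]
      exact hψ'
    have h3 := (h2.comp 0 (h1.comp 0 hh')).hasFDerivAt
    exact h3.congr_fderiv (ContinuousLinearMap.ext hL)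
  have hk0 : k 0 = ψ (t g) := by simp [k, hh0]
  let inv := hk.localInverse hk' (by simp)
  have hinv : ContDiffAt ℝ 2 inv (k 0) := hk.to_localInverse hk' (by simp)
  have hinv0 : inv (k 0) = 0 := hk.localInverse_apply_image hk' (by simp)
  have hinv' : HasFDerivAt inv (ContinuousLinearMap.id ℝ E₀) (k 0) :=
    ((hk.hasStrictFDerivAt' hk' (by simp)).to_localInverse).hasFDerivAt
  have hright : ∀ᶠ z in 𝓝 (k 0), k (inv z) = z :=
    (hk.hasStrictFDerivAt' hk' (by simp)).eventually_right_inverse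
  rw [hk0] at hinv hinv0 hinv' hright
  have hiψ : ContMDiffAt 𝓘(ℝ, E₀) 𝓘(ℝ, E₀) 2 (inv ∘ ψ) (t g) := hinv.contMDiffAt.comp (t g) hψc
  have hσ : ContMDiffAt 𝓘(ℝ, E₀) 𝓘(ℝ, E₁) 2 (h ∘ inv ∘ ψ) (t g) := hh.comp_of_eq hiψ hinv0
  have hσ0 : (h ∘ inv ∘ ψ) (t g) = g := by simp [hinv0, hh0]
  refine ⟨h ∘ inv ∘ ψ, hσ0, hσ, ?_, ?_⟩
  · have c1 : ∀ᶠ x in 𝓝 (t g), k (inv (ψ x)) = ψ x := hψc.continuousAt.eventually hright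
    have c2 : ∀ᶠ x in 𝓝 (t g), x ∈ ψ.source := extChartAt_source_mem_nhds (t g)
    have c3 : ∀ᶠ x in 𝓝 (t g), t ((h ∘ inv ∘ ψ) x) ∈ ψ.source := by
      refine (ht.continuous.continuousAt.comp hσ.continuousAt).preimage_mem_nhds ?_
      simp only [Function.comp_apply, hinv0, hh0]
      exact extChartAt_source_mem_nhds (t g)
    filter_upwards [c1, c2, c3] with x h1 h2 h3
    exact ψ.injOn h3 h2 h1
  · have h1 : HasMFDerivAt 𝓘(ℝ, E₀) 𝓘(ℝ, E₁) h (inv (ψ (t g))) L := by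
      rw [hinv0]
      exact hh'
    have h2 := h1.comp (t g) (hinv'.hasMFDerivAt.comp (t g) hψ')
    exact (congrArg (fun A : E₀ →L[ℝ] E₁ ↦ A (mfderiv 𝓘(ℝ, E₁) 𝓘(ℝ, E₀) t g v)) h2.mfderiv).trans
      hLv

end LocalSections

/-! ### Multiplying maps into the groupoid -/

section Multiplication

variable {E₀ : Type*} [NormedAddCommGroup E₀] [NormedSpace ℝ E₀]
  {M : Type*} [TopologicalSpace M] [ChartedSpace E₀ M] [IsManifold 𝓘(ℝ, E₀) ∞ M]
  {E₁ : Type*} [NormedAddCommGroup E₁] [NormedSpace ℝ E₁]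
  {G : Type*} [TopologicalSpace G] [ChartedSpace E₁ G] [IsManifold 𝓘(ℝ, E₁) ∞ G]
  {E' : Type*} [NormedAddCommGroup E'] [NormedSpace ℝ E']

omit [IsManifold 𝓘(ℝ, E₀) ∞ M] [IsManifold 𝓘(ℝ, E₁) ∞ G] in
theorem LieGroupoid.contMDiffAt_mul (𝒢 : LieGroupoid E₀ M E₁ G) {f₁ f₂ : E' → G} {y : E'}
    (h₁ : ContMDiffAt 𝓘(ℝ, E') 𝓘(ℝ, E₁) 2 f₁ y) (h₂ : ContMDiffAt 𝓘(ℝ, E') 𝓘(ℝ, E₁) 2 f₂ y)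
    (h : ∀ᶠ z in 𝓝 y, 𝒢.s (f₁ z) = 𝒢.t (f₂ z)) :
    ContMDiffAt 𝓘(ℝ, E') 𝓘(ℝ, E₁) 2 (fun z ↦ 𝒢.mul (f₁ z) (f₂ z)) y := by
  have h1 := (𝒢.smooth_mul (f₁ y, f₂ y) h.self_of_nhds).of_le (m := 2) (by decide)
  have h2 := (h₁.prodMk h₂).contMDiffWithinAt (s := {z | 𝒢.s (f₁ z) = 𝒢.t (f₂ z)})
  exact (ContMDiffWithinAt.comp y h1 h2 (fun z hz ↦ hz)).contMDiffAt h

omit [IsManifold 𝓘(ℝ, E₀) ∞ M] [IsManifold 𝓘(ℝ, E₁) ∞ G] in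
-- The chain rule holds for any derivative of the multiplication within the composable pairs.
-- Composability near `y` turns the composite derivative into an ordinary one, so the choice made in
-- `mfderivWithin` is harmless.
theorem LieGroupoid.mfderiv_mul_eq_tangentMul (𝒢 : LieGroupoid E₀ M E₁ G) {f₁ f₂ : E' → G} {y : E'}
    (h₁ : MDifferentiableAt 𝓘(ℝ, E') 𝓘(ℝ, E₁) f₁ y) (h₂ : MDifferentiableAt 𝓘(ℝ, E') 𝓘(ℝ, E₁) f₂ y)
    (h : ∀ᶠ z in 𝓝 y, 𝒢.s (f₁ z) = 𝒢.t (f₂ z)) (v : TangentSpace 𝓘(ℝ, E') y) :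
    mfderiv 𝓘(ℝ, E') 𝓘(ℝ, E₁) (fun z ↦ 𝒢.mul (f₁ z) (f₂ z)) y v =
      𝒢.tangentMul (tangentMap 𝓘(ℝ, E') 𝓘(ℝ, E₁) f₁ ⟨y, v⟩)
        (tangentMap 𝓘(ℝ, E') 𝓘(ℝ, E₁) f₂ ⟨y, v⟩) := by
  have h1 : HasMFDerivWithinAt (𝓘(ℝ, E₁).prod 𝓘(ℝ, E₁)) 𝓘(ℝ, E₁)
      (fun p : G × G ↦ 𝒢.mul p.1 p.2) {p : G × G | 𝒢.s p.1 = 𝒢.t p.2} (f₁ y, f₂ y) _ :=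
    ((𝒢.smooth_mul (f₁ y, f₂ y) h.self_of_nhds).mdifferentiableWithinAt
    (by simp)).hasMFDerivWithinAt
  have h2 := (h₁.hasMFDerivAt.prodMk h₂.hasMFDerivAt).hasMFDerivWithinAt
    (s := {z | 𝒢.s (f₁ z) = 𝒢.t (f₂ z)})
  have h3 := (HasMFDerivWithinAt.comp y (u := {p : G × G | 𝒢.s p.1 = 𝒢.t p.2}) h1 h2
    (fun z hz ↦ hz)).hasMFDerivAt h
  exact congrArg (fun L : E' →L[ℝ] E₁ ↦ L v) h3.mfderiv

omit [IsManifold 𝓘(ℝ, E₀) ∞ M] [IsManifold 𝓘(ℝ, E₁) ∞ G] in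
theorem tangentMap_congr_of_eventuallyEq {f f' : E' → M} {y : E'} (h : f =ᶠ[𝓝 y] f')
    (v : TangentSpace 𝓘(ℝ, E') y) :
    tangentMap 𝓘(ℝ, E') 𝓘(ℝ, E₀) f ⟨y, v⟩ = tangentMap 𝓘(ℝ, E') 𝓘(ℝ, E₀) f' ⟨y, v⟩ := by
  have h1 := h.mfderiv_eq (I := 𝓘(ℝ, E')) (I' := 𝓘(ℝ, E₀))
  have h2 : ∀ (a b : M) (u w : E₀), a = b → u = w →
      (⟨a, u⟩ : TangentBundle 𝓘(ℝ, E₀) M) = ⟨b, w⟩ := by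
    rintro a _ u _ rfl rfl; rfl
  exact h2 _ _ _ _ h.eq_of_nhds (congrArg (fun L : E' →L[ℝ] E₀ ↦ L v) h1)

omit [IsManifold 𝓘(ℝ, E₀) ∞ M] in
-- This moves multiplicativity to an identity of 1-forms on an open subset of a normed space, where
-- it can be differentiated.
theorem IsCoorientedContactGroupoid.pullback_mul {𝒢 : LieGroupoid E₀ M E₁ G} {α : OneForm E₁ G}
    {F : G → ℝ} (hα : IsCoorientedContactGroupoid 𝒢 α F) {f₁ f₂ : E' → G} {y : E'}
    (h₁ : ContMDiffAt 𝓘(ℝ, E') 𝓘(ℝ, E₁) 2 f₁ y) (h₂ : ContMDiffAt 𝓘(ℝ, E') 𝓘(ℝ, E₁) 2 f₂ y)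
    (h : ∀ᶠ z in 𝓝 y, 𝒢.s (f₁ z) = 𝒢.t (f₂ z)) :
    α.pullback (fun z ↦ 𝒢.mul (f₁ z) (f₂ z)) =ᶠ[𝓝 y]
      fun z ↦ α.pullback f₁ z + F (f₁ z) • α.pullback f₂ z := by
  have : IsManifold 𝓘(ℝ, E₁) 2 G := .of_le (n := ∞) (by decide)
  filter_upwards [(contMDiffAt_iff_contMDiffAt_nhds (by decide)).1 h₁,
    (contMDiffAt_iff_contMDiffAt_nhds (by decide)).1 h₂, h.eventually_nhds] with z hz₁ hz₂ hz
  have d₁ := hz₁.mdifferentiableAt (by simp)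
  have d₂ := hz₂.mdifferentiableAt (by simp)
  ext v
  have hcomp : tangentMap 𝓘(ℝ, E₁) 𝓘(ℝ, E₀) 𝒢.s (tangentMap 𝓘(ℝ, E') 𝓘(ℝ, E₁) f₁ ⟨z, v⟩) =
      tangentMap 𝓘(ℝ, E₁) 𝓘(ℝ, E₀) 𝒢.t (tangentMap 𝓘(ℝ, E') 𝓘(ℝ, E₁) f₂ ⟨z, v⟩) := by
    rw [← tangentMap_comp_at _ (𝒢.smooth_s.mdifferentiableAt (by simp)) d₁,
      ← tangentMap_comp_at _ (𝒢.smooth_t.mdifferentiableAt (by simp)) d₂]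
    exact tangentMap_congr_of_eventuallyEq hz v
  have h1 := hα.multiplicative _ _ hcomp
  exact (congrArg (fun u : E₁ ↦ (α (𝒢.mul (f₁ z) (f₂ z)) : E₁ →L[ℝ] ℝ) u)
    (𝒢.mfderiv_mul_eq_tangentMul d₁ d₂ hz v)).trans h1

end Multiplication

/-! ### The kernel of `dα` for a locally constant cocycle -/

section CharacteristicDirection

variable {E : Type*} [NormedAddCommGroup E] [NormedSpace ℝ E]
  {M : Type*} [TopologicalSpace M] [ChartedSpace E M]

theorem extDerivOneForm_congr (α : OneForm E M) {x y : M} (h : x = y) (v w : E) :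
    extDerivOneForm α x v w = extDerivOneForm α y v w := by
  subst h; rfl

theorem extDerivOneForm_swap (α : OneForm E M) (x : M) (v w : TangentSpace 𝓘(ℝ, E) x) :
    extDerivOneForm α x v w = -extDerivOneForm α x w v :=
  (neg_sub _ _).symm

variable {E₀ : Type*} [NormedAddCommGroup E₀] [NormedSpace ℝ E₀]
  {M : Type*} [TopologicalSpace M] [ChartedSpace E₀ M]
  {E₁ : Type*} [NormedAddCommGroup E₁] [NormedSpace ℝ E₁]
  {G : Type*} [TopologicalSpace G] [ChartedSpace E₁ G] [IsManifold 𝓘(ℝ, E₁) ∞ G]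

theorem IsCoorientedContactGroupoid.F_unit {𝒢 : LieGroupoid E₀ M E₁ G} {α : OneForm E₁ G}
    {F : G → ℝ} (hα : IsCoorientedContactGroupoid 𝒢 α F) (x : M) : F (𝒢.u x) = 1 := by
  have h := hα.F_mul (𝒢.u x) (𝒢.u x) (by rw [𝒢.s_unit, 𝒢.t_unit])
  have h2 := 𝒢.unit_mul (𝒢.u x)
  rw [𝒢.t_unit] at h2
  rw [h2] at h
  exact mul_left_cancel₀ (hα.F_ne_zero (𝒢.u x)) (by linarith)

/-- If `F` is locally constant, then the kernel of `dα` is tangent to the target fibres. -/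
theorem IsCoorientedContactGroupoid.mfderiv_t_eq_zero [FiniteDimensional ℝ E₀]
    [IsManifold 𝓘(ℝ, E₀) ∞ M] {𝒢 : LieGroupoid E₀ M E₁ G} {α : OneForm E₁ G}
    {F : G → ℝ} (hα : IsCoorientedContactGroupoid 𝒢 α F)
    (hF : ∀ g, ∀ᶠ g' in 𝓝 g, F g' = F g) {g : G} {v : TangentSpace 𝓘(ℝ, E₁) g}
    (hv : ∀ w, extDerivOneForm α g v w = 0) : mfderiv 𝓘(ℝ, E₁) 𝓘(ℝ, E₀) 𝒢.t g v = 0 := by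
  by_contra hne
  have : IsManifold 𝓘(ℝ, E₁) 2 G := .of_le (n := ∞) (by decide)
  have : IsManifold 𝓘(ℝ, E₁) 1 G := .of_le (n := ∞) (by decide)
  obtain ⟨σ, hσg, hσ, hσt, hσv⟩ := exists_local_section 𝒢.smooth_t g (𝒢.submersion_t g) v hne
  set x₀ := 𝒢.t g with hx₀
  set k₀ := 𝒢.u x₀ with hk₀
  set φ := extChartAt 𝓘(ℝ, E₁) k₀ with hφ
  let w : E₀ := mfderiv 𝓘(ℝ, E₁) 𝓘(ℝ, E₀) 𝒢.t g v
  let Du : E₀ →L[ℝ] E₁ := mfderiv 𝓘(ℝ, E₀) 𝓘(ℝ, E₁) 𝒢.u x₀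
  let Ds : E₁ →L[ℝ] E₀ := mfderiv 𝓘(ℝ, E₁) 𝓘(ℝ, E₀) 𝒢.s k₀
  let S : E₀ →L[ℝ] E₁ := mfderiv 𝓘(ℝ, E₀) 𝓘(ℝ, E₁) σ x₀
  have hDu : HasMFDerivAt 𝓘(ℝ, E₀) 𝓘(ℝ, E₁) 𝒢.u x₀ Du :=
    (𝒢.smooth_u.mdifferentiableAt (by simp)).hasMFDerivAt
  have hDs : HasMFDerivAt 𝓘(ℝ, E₁) 𝓘(ℝ, E₀) 𝒢.s k₀ Ds :=
    (𝒢.smooth_s.mdifferentiableAt (by simp)).hasMFDerivAt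
  have hS : HasMFDerivAt 𝓘(ℝ, E₀) 𝓘(ℝ, E₁) σ x₀ S :=
    (hσ.mdifferentiableAt (by simp)).hasMFDerivAt
  have hSw : S w = v := hσv
  have hsk₀ : 𝒢.s k₀ = x₀ := 𝒢.s_unit x₀
  have hDsDu : Ds (Du w) = w := by
    have h1 := hDs.comp x₀ hDu
    have h2 : 𝒢.s ∘ 𝒢.u = id := funext 𝒢.s_unit
    rw [h2] at h1
    exact congrArg (fun L : E₀ →L[ℝ] E₀ ↦ L w)
      (hasMFDerivAt_unique h1 (hasMFDerivAt_id (I := 𝓘(ℝ, E₀)) x₀))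
  -- The tangent vector to the units over `w = dt(v) ≠ 0`. The aim is `α(a) = 0` and `dα(a, -) = 0`,
  -- so that the contact condition gives `a = 0`, against `ds(a) = w`.
  set a : E₁ := Du w with ha
  have hf₁0 : φ.symm (φ k₀) = k₀ := extChartAt_to_inv k₀
  have hf₁ : ContMDiffAt 𝓘(ℝ, E₁) 𝓘(ℝ, E₁) 2 φ.symm (φ k₀) :=
    (contMDiffOn_extChartAt_symm k₀).contMDiffAt (extChartAt_target_mem_nhds k₀)
  have hf₁' : HasMFDerivAt 𝓘(ℝ, E₁) 𝓘(ℝ, E₁) φ.symm (φ k₀) (ContinuousLinearMap.id ℝ E₁) := by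
    have h1 := (hf₁.mdifferentiableAt (by simp)).hasMFDerivAt
    have h2 := mfderiv_extChartAt_symm_self (E := E₁) k₀
    exact h2 ▸ h1
  have hφc : ContMDiffAt 𝓘(ℝ, E₁) 𝓘(ℝ, E₁) 2 φ k₀ := contMDiffAt_extChartAt
  have hφ' : HasMFDerivAt 𝓘(ℝ, E₁) 𝓘(ℝ, E₁) φ k₀ (ContinuousLinearMap.id ℝ E₁) := by
    have h1 := (hφc.mdifferentiableAt (by simp)).hasMFDerivAt
    have h2 := mfderiv_extChartAt_self (I := 𝓘(ℝ, E₁)) (x := k₀)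
    exact h2 ▸ h1
  have hsf : ContMDiffAt 𝓘(ℝ, E₁) 𝓘(ℝ, E₀) 2 (𝒢.s ∘ φ.symm) (φ k₀) :=
    ((𝒢.smooth_s.of_le (m := 2) (by decide)).contMDiffAt (x := k₀)).comp_of_eq hf₁ hf₁0
  have hsf0 : (𝒢.s ∘ φ.symm) (φ k₀) = x₀ := (congrArg 𝒢.s hf₁0).trans hsk₀
  let f₂ : E₁ → G := σ ∘ 𝒢.s ∘ φ.symm
  have hf₂ : ContMDiffAt 𝓘(ℝ, E₁) 𝓘(ℝ, E₁) 2 f₂ (φ k₀) := hσ.comp_of_eq hsf hsf0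
  have hf₂0 : f₂ (φ k₀) = g := (congrArg σ hsf0).trans hσg
  have hf₂' : HasMFDerivAt 𝓘(ℝ, E₁) 𝓘(ℝ, E₁) f₂ (φ k₀) (S.comp Ds) := by
    have h1 : HasMFDerivAt 𝓘(ℝ, E₁) 𝓘(ℝ, E₀) 𝒢.s (φ.symm (φ k₀)) Ds := by
      rw [hf₁0]; exact hDs
    have h2 : HasMFDerivAt 𝓘(ℝ, E₀) 𝓘(ℝ, E₁) σ ((𝒢.s ∘ φ.symm) (φ k₀)) S := by
      rw [hsf0]; exact hS
    exact h2.comp _ (h1.comp _ hf₁')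
  have hcomp : ∀ᶠ y in 𝓝 (φ k₀), 𝒢.s (φ.symm y) = 𝒢.t (f₂ y) := by
    have h1 : Filter.Tendsto (𝒢.s ∘ φ.symm) (𝓝 (φ k₀)) (𝓝 x₀) := by
      have := hsf.continuousAt.tendsto
      rwa [hsf0] at this
    filter_upwards [h1.eventually hσt] with y hy using hy.symm
  -- In the chart at the unit, this is `k ↦ k · σ(s k)`. Along the units both it and `f₂ = σ ∘ s`
  -- restrict to σ, so both send `a` to `dσ(w) = v`.
  let f₃ : E₁ → G := fun y ↦ 𝒢.mul (φ.symm y) (f₂ y)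
  have hf₃ : ContMDiffAt 𝓘(ℝ, E₁) 𝓘(ℝ, E₁) 2 f₃ (φ k₀) := 𝒢.contMDiffAt_mul hf₁ hf₂ hcomp
  have hf₃0 : f₃ (φ k₀) = g := by
    change 𝒢.mul (φ.symm (φ k₀)) (f₂ (φ k₀)) = g
    rw [hf₁0, hf₂0]
    exact 𝒢.unit_mul g
  have hf₃a : (mfderiv 𝓘(ℝ, E₁) 𝓘(ℝ, E₁) f₃ (φ k₀) : E₁ →L[ℝ] E₁) a = v := by
    have h1 := (hf₃.mdifferentiableAt (by simp)).hasMFDerivAt.comp x₀ (hφ'.comp x₀ hDu)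
    have h2 : σ =ᶠ[𝓝 x₀] f₃ ∘ φ ∘ 𝒢.u := by
      have h3 : ∀ᶠ x in 𝓝 x₀, 𝒢.u x ∈ φ.source :=
        𝒢.smooth_u.continuous.continuousAt.preimage_mem_nhds (extChartAt_source_mem_nhds k₀)
      filter_upwards [h3, hσt] with x hx hx2
      have h4 : φ.symm (φ (𝒢.u x)) = 𝒢.u x := φ.left_inv hx
      change σ x = 𝒢.mul (φ.symm (φ (𝒢.u x))) (σ (𝒢.s (φ.symm (φ (𝒢.u x)))))
      rw [h4, 𝒢.s_unit]
      have h5 := 𝒢.unit_mul (σ x)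
      rw [hx2] at h5
      exact h5.symm
    exact (congrArg (fun L : E₀ →L[ℝ] E₁ ↦ L w)
      (hasMFDerivAt_unique (h1.congr_of_eventuallyEq h2) hS)).trans hSw
  have hf₂a : (mfderiv 𝓘(ℝ, E₁) 𝓘(ℝ, E₁) f₂ (φ k₀) : E₁ →L[ℝ] E₁) a = v := by
    refine (congrArg (fun L : E₁ →L[ℝ] E₁ ↦ L a) hf₂'.mfderiv).trans ?_
    exact (congrArg S hDsDu).trans hSw
  -- `F` equals 1 near the unit, so no `dF` term appears when this is differentiated.
  have hpull : α.pullback f₃ =ᶠ[𝓝 (φ k₀)] fun y ↦ α.pullback φ.symm y + α.pullback f₂ y := by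
    have h1 : ∀ᶠ y in 𝓝 (φ k₀), F (φ.symm y) = 1 := by
      have h2 := hF k₀
      rw [hα.F_unit x₀] at h2
      rw [← hf₁0] at h2
      exact hf₁.continuousAt.eventually h2
    filter_upwards [hα.pullback_mul hf₁ hf₂ hcomp, h1] with y hy hy1
    rw [hy, hy1, one_smul]
  -- Evaluated on `a`, the identity reads `α(v) = α(a) + α(v)`.
  have hαa : (α k₀ : E₁ →L[ℝ] ℝ) a = 0 := by
    have h1 := congrArg (fun L : E₁ →L[ℝ] ℝ ↦ L a) hpull.eq_of_nhds
    have h3 : α.pullback f₃ (φ k₀) a = (α g : E₁ →L[ℝ] ℝ) v :=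
      (α.apply_congr hf₃0 _).trans (congrArg (fun u : E₁ ↦ (α g : E₁ →L[ℝ] ℝ) u) hf₃a)
    have h2 : α.pullback f₂ (φ k₀) a = (α g : E₁ →L[ℝ] ℝ) v :=
      (α.apply_congr hf₂0 _).trans (congrArg (fun u : E₁ ↦ (α g : E₁ →L[ℝ] ℝ) u) hf₂a)
    have h4 : α.pullback φ.symm (φ k₀) a = (α k₀ : E₁ →L[ℝ] ℝ) a := oneFormInChart_self α k₀ a
    have h5 : α.pullback f₃ (φ k₀) a = α.pullback φ.symm (φ k₀) a + α.pullback f₂ (φ k₀) a := h1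
    linarith
  -- After `d`, the terms from `f₃` and `f₂` have the form `dα(v, -)` and vanish by hypothesis.
  have hda : ∀ b : E₁, extDerivOneForm α k₀ a b = 0 := by
    intro b
    obtain ⟨d₁, e₁⟩ := hα.contact.smooth.extDeriv_pullback hf₁
    obtain ⟨d₂, e₂⟩ := hα.contact.smooth.extDeriv_pullback hf₂
    obtain ⟨-, e₃⟩ := hα.contact.smooth.extDeriv_pullback hf₃
    have hd : fderiv ℝ (α.pullback f₃) (φ k₀) =
        fderiv ℝ (α.pullback φ.symm) (φ k₀) + fderiv ℝ (α.pullback f₂) (φ k₀) := by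
      rw [hpull.fderiv_eq, fderiv_fun_add d₁ d₂]
    have hvert : ∀ (f : E₁ → G), f (φ k₀) = g → ∀ c : E₁,
        (mfderiv 𝓘(ℝ, E₁) 𝓘(ℝ, E₁) f (φ k₀) : E₁ →L[ℝ] E₁) a = v →
        extDerivOneForm α (f (φ k₀)) (mfderiv 𝓘(ℝ, E₁) 𝓘(ℝ, E₁) f (φ k₀) a) c = 0 := by
      intro f hf c hfa
      exact ((extDerivOneForm_congr α hf _ c).trans
        (congrArg (fun z : E₁ ↦ extDerivOneForm α g z c) hfa)).trans (hv c)
    have q₂ := (e₂ a b).trans (hvert f₂ hf₂0 _ hf₂a)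
    have q₃ := (e₃ a b).trans (hvert f₃ hf₃0 _ hf₃a)
    have q₁ : extDerivOneForm α (φ.symm (φ k₀)) _ _ = extDerivOneForm α k₀ a b :=
      (extDerivOneForm_congr α hf₁0 _ _).trans
        (congrArg (fun L : E₁ →L[ℝ] E₁ ↦ extDerivOneForm α k₀ (L a) (L b)) hf₁'.mfderiv)
    rw [hd] at q₃
    simp only [_root_.add_apply] at q₃
    exact ((e₁ a b).trans q₁).symm.trans (by linarith)
  have ha0 : a = 0 := hα.contact.nondegenerate k₀ a hαa fun b _ ↦ hda b
  rw [ha0, map_zero] at hDsDu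
  exact hne hDsDu.symm

end CharacteristicDirection

/-! ### Contact forms and their rescalings `fα` -/

/-- The defining properties of the bivector of a contact form determine `i_{Λ♯β} dα`. -/
theorem contact_sharp_apply {V : Type*} [NormedAddCommGroup V] [NormedSpace ℝ V]
    [FiniteDimensional ℝ V] (a : V →L[ℝ] ℝ) (Ω : V →L[ℝ] V →L[ℝ] ℝ)
    (halt : ∀ v w, Ω v w = -Ω w v)
    (hnd : ∀ v, a v = 0 → (∀ w, a w = 0 → Ω v w = 0) → v = 0)
    (R : V) (haR : a R = 1) (hRΩ : ∀ w, Ω R w = 0) (Λ : (V →L[ℝ] ℝ) →ₗ[ℝ] V) (hΛa : Λ a = 0)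
    (hΛ : ∀ v w, a v = 0 → a w = 0 → Ω w (Λ (Ω v)) = Ω v w) (β : V →L[ℝ] ℝ) (w : V) :
    Ω (Λ β) w = -β w + β R * a w := by
  let H : Submodule ℝ V := LinearMap.ker a.toLinearMap
  let T : H →ₗ[ℝ] Module.Dual ℝ H :=
    LinearMap.mk₂ ℝ (fun v w : H ↦ Ω v w) (by simp) (by simp) (by simp) (by simp)
  have hT : Function.Injective T := by
    rw [← LinearMap.ker_eq_bot, LinearMap.ker_eq_bot']
    intro v hv
    exact Subtype.ext (hnd v v.2 fun w hw ↦ LinearMap.congr_fun hv ⟨w, hw⟩)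
  have hT' : Function.Surjective T :=
    (LinearMap.injective_iff_surjective_of_finrank_eq_finrank
      Subspace.dual_finrank_eq.symm).1 hT
  -- On `H = ker a` the form is non-degenerate, so β agrees there with some `i_v Ω`, `v ∈ H`. The
  -- two differ by a multiple of `a`, which `Λ` kills.
  obtain ⟨v, hv⟩ := hT' (β.toLinearMap.domRestrict H)
  have hproj : ∀ z, a (z - a z • R) = 0 := fun z ↦ by simp [haR]
  have hvz : Ω v = β - β R • a := by
    ext z
    have h1 : Ω v (z - a z • R) = β (z - a z • R) :=
      LinearMap.congr_fun hv ⟨z - a z • R, hproj z⟩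
    have h2 : Ω v R = 0 := by rw [halt, hRΩ, neg_zero]
    simp only [map_sub, map_smul, h2, smul_eq_mul] at h1
    simp only [_root_.sub_apply, _root_.smul_apply, smul_eq_mul]
    linarith
  have hΛv : Λ (Ω v) = Λ β := by rw [hvz, map_sub, map_smul, hΛa, smul_zero, sub_zero]
  have h1 := hΛ v _ v.2 (hproj w)
  rw [hΛv, halt, halt v] at h1
  have h2 : Ω v (w - a w • R) = β (w - a w • R) :=
      LinearMap.congr_fun hv ⟨w - a w • R, hproj w⟩
  rw [halt] at h2
  have h3 : Ω (Λ β) R = 0 := by rw [halt, hRΩ, neg_zero]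
  simp only [map_sub, map_smul, h3, smul_eq_mul] at h1 h2
  linarith

section Conformal

variable {E : Type*} [NormedAddCommGroup E] [NormedSpace ℝ E]
  {M : Type*} [TopologicalSpace M] [ChartedSpace E M] [IsManifold 𝓘(ℝ, E) ∞ M]

omit [IsManifold 𝓘(ℝ, E) ∞ M] in
theorem IsContactBivector.form_apply {α : OneForm E M} {Λ : SharpField E M}
    (hΛ : IsContactBivector α Λ) (x : M) (β : Cotangent E x) : α x (Λ x β) = 0 := by
  have h := hΛ.skew x (α x + β)
  rw [map_add, hΛ.apply_form, zero_add] at h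
  have h2 := hΛ.skew x β
  have h3 : (α x + β) (Λ x β) = α x (Λ x β) + β (Λ x β) := rfl
  linarith

theorem IsContactBivector.extDeriv_apply [FiniteDimensional ℝ E] {α : OneForm E M}
    (hα : IsContactForm α) {Λ : SharpField E M} (hΛ : IsContactBivector α Λ) {R : VField E M}
    (hR : IsReebVField α R) (x : M) (β : Cotangent E x) (w : TangentSpace 𝓘(ℝ, E) x) :
    extDerivOneForm α x (Λ x β) w = -β w + β (R x) * α x w := by
  let D : E →L[ℝ] E →L[ℝ] ℝ := fderiv ℝ (oneFormInChart α x) (extChartAt 𝓘(ℝ, E) x x)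
  exact contact_sharp_apply (V := E) (α x) (D - D.flip) (extDerivOneForm_swap α x)
    (hα.nondegenerate x) (R x) (hR.apply_eq_one x) (hR.extDeriv_eq_zero x) (Λ x) (hΛ.apply_form x)
    (fun v w hv hw ↦ hΛ.inverse x v w hv hw _ _ (fun _ ↦ rfl) (fun _ ↦ rfl)) β w

/-- On `ker α` the term `df ∧ α` vanishes, so `d(fα) = f dα` there. -/
theorem IsContactForm.smul {α : OneForm E M} (hα : IsContactForm α) {f : M → ℝ}
    (hf : SmoothFun E f) (hf0 : ∀ x, f x ≠ 0) : IsContactForm (fun x ↦ f x • α x) where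
  smooth := ContMDiff.smul_section hf hα.smooth
  ne_zero x := smul_ne_zero (hf0 x) (hα.ne_zero x)
  nondegenerate x v hv h := by
    have hv' : α x v = 0 := (mul_eq_zero.1 (show f x * α x v = 0 from hv)).resolve_left (hf0 x)
    refine hα.nondegenerate x v hv' fun w hw ↦ ?_
    have h1 := h w (show f x * α x w = 0 by rw [hw, mul_zero])
    rw [extDerivOneForm_smul hα.smooth hf, hv', hw, mul_zero, mul_zero, sub_zero, add_zero] at h1
    exact (mul_eq_zero.1 h1).resolve_left (hf0 x)

theorem IsContactBivector.smul {α : OneForm E M} (hα : IsContactForm α) {Λ : SharpField E M}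
    (hΛ : IsContactBivector α Λ) {f : M → ℝ} (hf : SmoothFun E f) (hf0 : ∀ x, f x ≠ 0) :
    IsContactBivector (fun x ↦ f x • α x) (fun x ↦ (f x)⁻¹ • Λ x) where
  skew x β := by
    have h : β ((f x)⁻¹ • Λ x β) = (f x)⁻¹ * β (Λ x β) := map_smul β _ _
    exact h.trans (by rw [hΛ.skew, mul_zero])
  apply_form x := by
    change (f x)⁻¹ • Λ x (f x • α x) = 0
    rw [map_smul, hΛ.apply_form, smul_zero, smul_zero]
  inverse x v w hv hw β γ hβ hγ := by
    have hv' : α x v = 0 := (mul_eq_zero.1 (show f x * α x v = 0 from hv)).resolve_left (hf0 x)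
    have hw' : α x w = 0 := (mul_eq_zero.1 (show f x * α x w = 0 from hw)).resolve_left (hf0 x)
    -- For `u ∈ ker α`, `i_u d(fα) = f i_u dα + df(u) α`. Since `Λ♯ α = 0`, the second summand does
    -- not matter.
    have hred : ∀ u (δ : Cotangent E x), α x u = 0 →
        (∀ z, δ z = extDerivOneForm (fun x ↦ f x • α x) x u z) →
        ∀ z, ((f x)⁻¹ • (δ - dfun E f x u • α x)) z = extDerivOneForm α x u z := by
      intro u δ hu hδ z
      have h1 := hδ z
      rw [extDerivOneForm_smul hα.smooth hf, hu, mul_zero, sub_zero] at h1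
      change (f x)⁻¹ * (δ z - dfun E f x u * α x z) = _
      rw [h1, add_sub_cancel_right, inv_mul_cancel_left₀ (hf0 x)]
    have h1 := hΛ.inverse x v w hv' hw' _ _ (hred v β hv' hβ) (hred w γ hw' hγ)
    rw [(Λ x).map_smul, (Λ x).map_sub, (Λ x).map_smul, hΛ.apply_form, smul_zero, sub_zero] at h1
    have h2 : (f x)⁻¹ * (γ ((f x)⁻¹ • Λ x β) - dfun E f x w * α x ((f x)⁻¹ • Λ x β)) =
      extDerivOneForm α x v w := h1
    have h3 : α x ((f x)⁻¹ • Λ x β) = 0 := by rw [map_smul, hΛ.form_apply, smul_zero]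
    rw [h3, mul_zero, sub_zero] at h2
    rw [extDerivOneForm_smul hα.smooth hf, hv', hw', mul_zero, mul_zero, sub_zero, add_zero, ← h2,
      mul_inv_cancel_left₀ (hf0 x)]
    rfl

/-- The correction `Λ♯(df)` is there because `i_{Λ♯(df)} dα = -df + df(R) α`, which is what cancels
the contribution of `df ∧ α`. -/
theorem IsReebVField.smul [FiniteDimensional ℝ E] {α : OneForm E M} (hα : IsContactForm α)
    {Λ : SharpField E M} (hΛ : IsContactBivector α Λ) {R : VField E M} (hR : IsReebVField α R)
    {f : M → ℝ} (hf : SmoothFun E f) (hf0 : ∀ x, f x ≠ 0) :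
    IsReebVField (fun x ↦ f x • α x)
      (fun x ↦ (f x)⁻¹ • (R x - (f x)⁻¹ • Λ x (dfun E f x))) := by
  have hαY : ∀ x, α x (R x - (f x)⁻¹ • Λ x (dfun E f x)) = 1 := fun x ↦ by
    rw [map_sub, map_smul, hΛ.form_apply, smul_zero, sub_zero, hR.apply_eq_one]
  refine ⟨fun x ↦ ?_, fun x w ↦ ?_⟩
  · change f x * α x ((f x)⁻¹ • (R x - (f x)⁻¹ • Λ x (dfun E f x))) = 1
    rw [map_smul, hαY, smul_eq_mul, mul_one, mul_inv_cancel₀ (hf0 x)]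
  · let D : E →L[ℝ] E →L[ℝ] ℝ := fderiv ℝ (oneFormInChart α x) (extChartAt 𝓘(ℝ, E) x x)
    have hlin : ∀ (c d : ℝ) (u u' : TangentSpace 𝓘(ℝ, E) x),
        extDerivOneForm α x (c • (u - d • u')) w =
          c * (extDerivOneForm α x u w - d * extDerivOneForm α x u' w) := by
      have hA : ∀ (A : E →L[ℝ] E →L[ℝ] ℝ) (c d : ℝ) (u u' w : E),
          A (c • (u - d • u')) w = c * (A u w - d * A u' w) := fun A c d u u' w ↦ by
        simp only [map_sub, map_smul, _root_.sub_apply, _root_.smul_apply, smul_eq_mul]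
      exact fun c d u u' ↦ hA (D - D.flip) c d u u' w
    have hdf : dfun E f x (R x - (f x)⁻¹ • Λ x (dfun E f x)) = dfun E f x (R x) := by
      rw [map_sub, map_smul, hΛ.skew, smul_zero, sub_zero]
    rw [extDerivOneForm_smul hα.smooth hf, hlin, hR.extDeriv_eq_zero,
      hΛ.extDeriv_apply hα hR, map_smul, map_smul, hdf, hαY]
    simp only [smul_eq_mul]
    field_simp [hf0 x]
    ring

end Conformal

/-! ### From the Jacobi bracket to the Poisson bracket -/

section Jacobi

variable {E : Type*} [NormedAddCommGroup E] [NormedSpace ℝ E]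
  {M : Type*} [TopologicalSpace M] [ChartedSpace E M]

theorem IsBivectorField.apply_swap {Λ : SharpField E M} (hΛ : IsBivectorField Λ) (x : M)
    (β γ : Cotangent E x) : γ (Λ x β) = -β (Λ x γ) := by
  have h := hΛ.skew x (β + γ)
  have h2 : ∀ u, (β + γ) u = β u + γ u := fun _ ↦ rfl
  rw [h2, (Λ x).map_add, map_add, map_add, hΛ.skew, hΛ.skew] at h
  linarith

theorem IsBivectorField.smul {Λ : SharpField E M} (hΛ : IsBivectorField Λ) {c : M → ℝ}
    (hc : SmoothFun E c) : IsBivectorField (fun x ↦ c x • Λ x) where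
  skew x β := by
    have h : β (c x • Λ x β) = c x * β (Λ x β) := map_smul β _ _
    exact h.trans (by rw [hΛ.skew, mul_zero])
  smooth f g hf hg := by
    have h : (fun x ↦ dfun E g x ((c x • Λ x) (dfun E f x))) =
        fun x ↦ c x * dfun E g x (Λ x (dfun E f x)) := funext fun x ↦ map_smul (dfun E g x) _ _
    rw [h]
    exact hc.mul (hΛ.smooth f g hf hg)

theorem dfun_exp {φ : M → ℝ} (hφ : SmoothFun E φ) (x : M) :
    dfun E (fun x ↦ Real.exp (φ x)) x = Real.exp (φ x) • dfun E φ x := by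
  have h1 := (hφ.mdifferentiableAt (x := x) (by simp)).hasMFDerivAt
  have h2 := (Real.hasDerivAt_exp (φ x)).hasFDerivAt.hasMFDerivAt.comp x h1
  refine ContinuousLinearMap.ext fun v ↦ ?_
  refine (congrArg (fun L : E →L[ℝ] ℝ ↦ L v) h2.mfderiv).trans ?_
  exact mul_comm (dfun E φ x v) _

theorem SmoothFun.exp_neg {κ : M → ℝ} (hκ : SmoothFun E κ) :
    SmoothFun E (fun x ↦ Real.exp (-κ x)) :=
  Real.contDiff_exp.contMDiff.comp hκ.neg

theorem dfun_exp_neg_mul {κ f : M → ℝ} (hκ : SmoothFun E κ) (hf : SmoothFun E f) (x : M) :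
    dfun E (fun x ↦ Real.exp (-κ x) * f x) x =
      Real.exp (-κ x) • (dfun E f x - f x • dfun E κ x) := by
  have h1 : dfun E (fun x ↦ -κ x) x = -dfun E κ x := mvfderiv_fun_neg
  rw [dfun, mvfderiv_fun_mul ((SmoothFun.exp_neg hκ).mdifferentiableAt (by simp))
    (hf.mdifferentiableAt (by simp)), ← dfun, ← dfun, dfun_exp (φ := fun x ↦ -κ x) hκ.neg, h1]
  module

/-- If `R = Λ♯(dκ)`, multiplication by `e^{-κ}` takes the bracket of `e^{-κ}Λ` to the bracket of
`(Λ, R)`. -/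
theorem jacobiBracket_exp_neg_mul {Λ : SharpField E M} {R : VField E M} (hΛ : IsBivectorField Λ)
    {κ : M → ℝ} (hκ : SmoothFun E κ) (hR : ∀ x, Λ x (dfun E κ x) = R x) {f g : M → ℝ}
    (hf : SmoothFun E f) (hg : SmoothFun E g) :
    jacobiBracket Λ R (fun x ↦ Real.exp (-κ x) * f x) (fun x ↦ Real.exp (-κ x) * g x) =
      fun x ↦ Real.exp (-κ x) * poissonBracket (fun x ↦ Real.exp (-κ x) • Λ x) f g x := by
  funext x
  simp only [jacobiBracket, poissonBracket]
  rw [dfun_exp_neg_mul hκ hf, dfun_exp_neg_mul hκ hg, ← hR]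
  set e := Real.exp (-κ x)
  have hκκ := hΛ.skew x (dfun E κ x)
  have h1 := hΛ.apply_swap x (dfun E f x) (dfun E κ x)
  have happ : ∀ (h : M → ℝ) (u : TangentSpace 𝓘(ℝ, E) x),
      (e • (dfun E h x - h x • dfun E κ x)) u = e * (dfun E h x u - h x * dfun E κ x u) :=
    fun h u ↦ rfl
  have h2 : (e • Λ x) (dfun E f x) = e • Λ x (dfun E f x) := rfl
  rw [happ, happ, happ, h2, map_smul, map_smul, map_smul, map_smul, map_sub, map_sub, map_sub,
    (Λ x).map_smul, map_smul, map_smul, hκκ, h1]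
  simp only [smul_eq_mul]
  ring

/-- Multiplication by `e^{-κ}` is injective and intertwines the brackets, so the Jacobi identity
transfers. -/
theorem IsJacobiManifold.isPoissonBivector_exp_neg_smul [IsManifold 𝓘(ℝ, E) ∞ M]
    {Λ : SharpField E M} {R : VField E M} (h : IsJacobiManifold Λ R)
    {κ : M → ℝ} (hκ : SmoothFun E κ) (hR : ∀ x, Λ x (dfun E κ x) = R x) :
    IsPoissonBivector (fun x ↦ Real.exp (-κ x) • Λ x) where
  bivector := h.bivector.smul (SmoothFun.exp_neg hκ)
  jacobi f g k hf hg hk x := by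
    have hP := h.bivector.smul (SmoothFun.exp_neg hκ)
    have hs : ∀ {f : M → ℝ}, SmoothFun E f → SmoothFun E (fun x ↦ Real.exp (-κ x) * f x) :=
      fun hf ↦ (SmoothFun.exp_neg hκ).mul hf
    have hJ := h.jacobi _ _ _ (hs hf) (hs hg) (hs hk) x
    rw [jacobiBracket_exp_neg_mul h.bivector hκ hR hf hg,
      jacobiBracket_exp_neg_mul h.bivector hκ hR hg hk,
      jacobiBracket_exp_neg_mul h.bivector hκ hR hk hf,
      jacobiBracket_exp_neg_mul h.bivector hκ hR hf (show SmoothFun E (poissonBracket _ g k) from hP.smooth _ _ hg hk),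
      jacobiBracket_exp_neg_mul h.bivector hκ hR hg (show SmoothFun E (poissonBracket _ k f) from hP.smooth _ _ hk hf),
      jacobiBracket_exp_neg_mul h.bivector hκ hR hk (show SmoothFun E (poissonBracket _ f g) from hP.smooth _ _ hf hg)] at hJ
    rw [← mul_add, ← mul_add] at hJ
    exact (mul_eq_zero.1 hJ).resolve_left (Real.exp_pos _).ne'

theorem jacobiBracket_zero (Λ : SharpField E M) : jacobiBracket Λ 0 = poissonBracket Λ := by
  funext f g x
  simp [jacobiBracket, poissonBracket]

theorem isJacobiManifold_zero_iff [IsManifold 𝓘(ℝ, E) ∞ M] {Λ : SharpField E M} :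
    IsJacobiManifold Λ 0 ↔ IsPoissonBivector Λ := by
  refine ⟨fun h ↦ ⟨h.bivector, ?_⟩, fun h ↦ ⟨h.bivector, contMDiff_zeroSection _ _, ?_⟩⟩
  · rw [← jacobiBracket_zero]; exact h.jacobi
  · rw [jacobiBracket_zero]; exact h.jacobi

theorem charDist_eq_range {Λ : SharpField E M} {R : VField E M} {x : M} {β : Cotangent E x}
    (h : Λ x β = R x) : charDist Λ R x = LinearMap.range (Λ x) :=
  sup_eq_left.2 ((Submodule.span_singleton_le_iff_mem _ _).2 ⟨β, h⟩)

theorem IsLeaf.finrank_charDist {F : Type*} [NormedAddCommGroup F] [NormedSpace ℝ F]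
    {Λ : SharpField E M} {R : VField E M} {N : Type*} [TopologicalSpace N] [ChartedSpace F N]
    {ι : N → M} (hι : IsLeaf F Λ R ι) (p : N) :
    Module.finrank ℝ (charDist Λ R (ι p)) = Module.finrank ℝ F := by
  rw [← hι.tangent p]
  exact LinearMap.finrank_range_of_inj (hι.immersion p)

end Jacobi

/-! ### Rescaling the contact groupoid -/

theorem Real.sign_mul (a b : ℝ) : Real.sign (a * b) = Real.sign a * Real.sign b := by
  rcases lt_trichotomy a 0 with ha | rfl | ha <;> rcases lt_trichotomy b 0 with hb | rfl | hb <;>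
    simp [Real.sign_of_neg, Real.sign_of_pos, mul_neg_of_neg_of_pos, mul_neg_of_pos_of_neg,
      mul_pos_of_neg_of_neg, *]

theorem Real.sign_mul_abs (a : ℝ) : Real.sign a * |a| = a := by
  rcases lt_trichotomy a 0 with ha | rfl | ha
  · rw [Real.sign_of_neg ha, abs_of_neg ha]; ring
  · simp
  · rw [Real.sign_of_pos ha, abs_of_pos ha, one_mul]

theorem eventually_sign_eq {X : Type*} [TopologicalSpace X] {F : X → ℝ} (hF : Continuous F)
    (x : X) (h0 : F x ≠ 0) : ∀ᶠ y in 𝓝 x, Real.sign (F y) = Real.sign (F x) := by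
  rcases lt_or_gt_of_ne h0 with h | h
  · filter_upwards [hF.continuousAt.eventually_lt_const h] with y hy
    rw [Real.sign_of_neg hy, Real.sign_of_neg h]
  · filter_upwards [hF.continuousAt.eventually_const_lt h] with y hy
    rw [Real.sign_of_pos hy, Real.sign_of_pos h]

section Groupoids

variable {E₀ : Type*} [NormedAddCommGroup E₀] [NormedSpace ℝ E₀]
  {M : Type*} [TopologicalSpace M] [ChartedSpace E₀ M]
  {E₁ : Type*} [NormedAddCommGroup E₁] [NormedSpace ℝ E₁]
  {G : Type*} [TopologicalSpace G] [ChartedSpace E₁ G] [IsManifold 𝓘(ℝ, E₁) ∞ G]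
  {𝒢 : LieGroupoid E₀ M E₁ G} {α : OneForm E₁ G} {F : G → ℝ} {κ : M → ℝ}

omit [IsManifold 𝓘(ℝ, E₁) ∞ G] in
theorem IsPrimitive.smooth_exp_comp_t (hκ : IsPrimitive 𝒢 (reebCocycle F) κ) :
    SmoothFun E₁ (fun g ↦ Real.exp (κ (𝒢.t g))) :=
  Real.contDiff_exp.contMDiff.comp (hκ.1.comp 𝒢.smooth_t)

theorem IsCoorientedContactGroupoid.smul_sign (hα : IsCoorientedContactGroupoid 𝒢 α F)
    (hκ : IsPrimitive 𝒢 (reebCocycle F) κ) :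
    IsCoorientedContactGroupoid 𝒢 (fun g ↦ Real.exp (κ (𝒢.t g)) • α g)
      (fun g ↦ Real.sign (F g)) where
  contact := hα.contact.smul hκ.smooth_exp_comp_t fun _ ↦ (Real.exp_pos _).ne'
  smooth_F g := contMDiffAt_const.congr_of_eventuallyEq
    (eventually_sign_eq hα.smooth_F.continuous g (hα.F_ne_zero g))
  F_ne_zero g h := hα.F_ne_zero g (Real.sign_eq_zero_iff.1 h)
  F_mul g h hgh := by rw [hα.F_mul g h hgh, Real.sign_mul]
  multiplicative X Y hXY := by
    have hst : 𝒢.s X.1 = 𝒢.t Y.1 := congrArg TotalSpace.proj hXY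
    have h1 := hα.multiplicative X Y hXY
    -- The primitive equation exponentiates to `e^{s^*κ} = |F| e^{t^*κ}`; composability then
    -- replaces the source of the first arrow by the target of the second.
    have h2 : Real.exp (κ (𝒢.t X.1)) * F X.1 =
        Real.sign (F X.1) * Real.exp (κ (𝒢.t Y.1)) := by
      have h3 : Real.exp (κ (𝒢.s X.1)) = |F X.1| * Real.exp (κ (𝒢.t X.1)) := by
        have h4 := hκ.2 X.1
        rw [← Real.exp_log (abs_pos.2 (hα.F_ne_zero X.1)), ← Real.exp_add]
        congr 1
        simp only [reebCocycle] at h4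
        linarith
      rw [← hst, h3, ← mul_assoc, Real.sign_mul_abs, mul_comm]
    change Real.exp (κ (𝒢.t (𝒢.mul X.1 Y.1))) * α (𝒢.mul X.1 Y.1) (𝒢.tangentMul X Y) =
      Real.exp (κ (𝒢.t X.1)) * α X.1 X.2 +
        Real.sign (F X.1) * (Real.exp (κ (𝒢.t Y.1)) * α Y.1 Y.2)
    rw [𝒢.t_mul _ _ hst, h1]
    linear_combination (α Y.1 Y.2) * h2

variable [IsManifold 𝓘(ℝ, E₀) ∞ M] [FiniteDimensional ℝ E₀] [FiniteDimensional ℝ E₁]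
  {Λ : SharpField E₀ M} {R : VField E₀ M}

/-- The rescaled contact groupoid has a Reeb vector field tangent to the target fibres, and its
bivector is pushed forward to `e^{-κ}Λ`. -/
theorem Integrates.exists_rescaled (h : Integrates 𝒢 α F Λ R)
    (hκ : IsPrimitive 𝒢 (reebCocycle F) κ) :
    (∀ x, Λ x (dfun E₀ κ x) = R x) ∧
    ∃ (Λα : SharpField E₁ G) (Rα : VField E₁ G),
      IsContactBivector (fun g ↦ Real.exp (κ (𝒢.t g)) • α g) Λα ∧
      IsReebVField (fun g ↦ Real.exp (κ (𝒢.t g)) • α g) Rα ∧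
      (∀ (g : G) (β : Cotangent E₀ (𝒢.t g)),
        mfderiv 𝓘(ℝ, E₁) 𝓘(ℝ, E₀) 𝒢.t g
          (Λα g (β.comp (mfderiv 𝓘(ℝ, E₁) 𝓘(ℝ, E₀) 𝒢.t g))) =
            Real.exp (-κ (𝒢.t g)) • Λ (𝒢.t g) β) ∧
      (∀ g : G, mfderiv 𝓘(ℝ, E₁) 𝓘(ℝ, E₀) 𝒢.t g (Rα g) = 0) := by
  obtain ⟨Λα, Rα, hΛα, hRα, hΛ, hR⟩ := h.jacobi_map
  have hα := h.contact_groupoid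
  have hf := hκ.smooth_exp_comp_t
  have hf0 : ∀ g, Real.exp (κ (𝒢.t g)) ≠ 0 := fun _ ↦ (Real.exp_pos _).ne'
  have hreeb := hRα.smul hα.contact hΛα hf hf0
  have hvert : ∀ g, mfderiv 𝓘(ℝ, E₁) 𝓘(ℝ, E₀) 𝒢.t g _ = 0 := fun g ↦
    (hα.smul_sign hκ).mfderiv_t_eq_zero
      (fun g ↦ eventually_sign_eq hα.smooth_F.continuous g (hα.F_ne_zero g))
      (hreeb.extDeriv_eq_zero g)
  refine ⟨fun x ↦ ?_, _, _, hΛα.smul hα.contact hf hf0, hreeb, fun g β ↦ ?_, hvert⟩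
  · have h1 : ∀ g, Λ (𝒢.t g) (dfun E₀ κ (𝒢.t g)) = R (𝒢.t g) := fun g ↦ by
      have hd : dfun E₁ (fun g ↦ Real.exp (κ (𝒢.t g))) g = Real.exp (κ (𝒢.t g)) •
          (dfun E₀ κ (𝒢.t g)).comp (mfderiv 𝓘(ℝ, E₁) 𝓘(ℝ, E₀) 𝒢.t g) := by
        rw [dfun_exp (φ := fun g ↦ κ (𝒢.t g)) (hκ.1.comp 𝒢.smooth_t)]
        congr 1
        exact mvfderiv_comp g (hκ.1.mdifferentiableAt (by simp))
          (𝒢.smooth_t.mdifferentiableAt (by simp))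
      have h2 := hvert g
      rw [hd, (Λα g).map_smul, smul_smul, inv_mul_cancel₀ (hf0 g), one_smul, map_smul, map_sub,
        hΛ, hR] at h2
      exact (sub_eq_zero.1 ((smul_eq_zero.1 h2).resolve_left (inv_ne_zero (hf0 g)))).symm
    have h2 := h1 (𝒢.u x)
    rwa [𝒢.t_unit] at h2
  · change mfderiv 𝓘(ℝ, E₁) 𝓘(ℝ, E₀) 𝒢.t g ((Real.exp (κ (𝒢.t g)))⁻¹ • Λα g _) = _
    rw [map_smul, hΛ, Real.exp_neg]

end Groupoids

/-! ### The proposition -/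

theorem proposition4p4
    {E₀ : Type*} [NormedAddCommGroup E₀] [NormedSpace ℝ E₀] [FiniteDimensional ℝ E₀]
    {M : Type u} [TopologicalSpace M] [T2Space M] [ChartedSpace E₀ M] [IsManifold 𝓘(ℝ, E₀) ∞ M]
    {E₁ : Type*} [NormedAddCommGroup E₁] [NormedSpace ℝ E₁] [FiniteDimensional ℝ E₁]
    {G : Type*} [TopologicalSpace G] [T2Space G] [ChartedSpace E₁ G] [IsManifold 𝓘(ℝ, E₁) ∞ G]
    (𝒢 : LieGroupoid E₀ M E₁ G) (α : OneForm E₁ G) (F : G → ℝ)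
    (Λ : SharpField E₀ M) (R : VField E₀ M)
    (hint : Integrates 𝒢 α F Λ R)
    (hcob : ∃ κ : M → ℝ, IsPrimitive 𝒢 (reebCocycle F) κ) :
    -- the leaves of the characteristic foliation are even dimensional
    ((∀ x : M, Even (Module.finrank ℝ (charDist Λ R x))) ∧
      (∀ (d : ℕ) (N : Type u) [TopologicalSpace N] [ChartedSpace (EuclideanSpace ℝ (Fin d)) N]
        [IsManifold 𝓘(ℝ, EuclideanSpace ℝ (Fin d)) ∞ N] (ι : N → M),
        IsLeaf (EuclideanSpace ℝ (Fin d)) Λ R ι → Even d)) ∧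
    ∀ κ : M → ℝ, IsPrimitive 𝒢 (reebCocycle F) κ →
      IsPoissonBivector (fun x ↦ Real.exp (-κ x) • Λ x) ∧
      Integrates 𝒢 (fun g ↦ Real.exp (κ (𝒢.t g)) • α g) (fun g ↦ Real.sign (F g))
        (fun x ↦ Real.exp (-κ x) • Λ x) 0 ∧
      ((∀ x, R x = 0) → IsPoissonBivector Λ ∧ IsCasimir Λ κ) := by

  have hmain : ∀ κ, IsPrimitive 𝒢 (reebCocycle F) κ → ∀ x, Λ x (dfun E₀ κ x) = R x :=
    fun κ hκ ↦ (hint.exists_rescaled hκ).1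
  have heven : ∀ x : M, Even (Module.finrank ℝ (charDist Λ R x)) := by
    obtain ⟨κ, hκ⟩ := hcob
    intro x
    -- `R = Λ♯(dκ)` adds no new direction to the image of `Λ♯`.
    rw [charDist_eq_range (hmain κ hκ x)]
    exact even_finrank_range_of_skew (V := E₀) (Λ x) (hint.jacobi_manifold.bivector.skew x)
  refine ⟨⟨heven, fun d N _ _ _ ι hι ↦ ?_⟩, fun κ hκ ↦ ?_⟩
  · have := hι.connected
    obtain ⟨p⟩ : Nonempty N := inferInstance
    have h := heven (ι p)
    rw [hι.finrank_charDist, finrank_euclideanSpace_fin] at h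
    exact h
  · have hP := hint.jacobi_manifold.isPoissonBivector_exp_neg_smul hκ.1 (hmain κ hκ)
    refine ⟨hP, ⟨hint.contact_groupoid.smul_sign hκ, isJacobiManifold_zero_iff.2 hP,
      (hint.exists_rescaled hκ).2⟩, fun hR ↦ ⟨?_, hκ.1, fun x ↦ ?_⟩⟩
    · have hR0 : R = 0 := funext hR
      exact isJacobiManifold_zero_iff.1 (hR0 ▸ hint.jacobi_manifold)
    · rw [hmain κ hκ, hR]
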